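/- Let $\Omega=(0,1)^2\subset\mathbb R^2$ with boundary $\Gamma$ and open bottom, top, left, right sides $\Gamma_b,\Gamma_t,\Gamma_l,\Gamma_r$. For a set $S$ of sides let $\Gamma_S$ be the interior, relative to $\Gamma$, of the closure of the union of the sides in $S$; write $\Gamma_{b,l}$ etc. (so $\Gamma_{b,t,l,r}=\Gamma$). For $\Gamma_0\subset\Gamma$, let $\operatorname{grad}_{\Gamma_0}$ and $\operatorname{rot}_{\Gamma_0}$ be the closures, as unbounded operators $L^2(\Omega)\to L^2(\Omega)^2$ and $L^2(\Omega)^2\to L^2(\Omega)$, of the classical operators $u\mapsto\nabla u$ and $E\mapsto\partial_1E_2-\partial_2E_1$ defined on the restrictions to $\Omega$ of smooth functions, respectively vector fields, with compact support in $\mathbb R^2$ at positive distance from $\Gamma_0$. For a densely defined closed operator $A$ between Hilbert spaces let $c_A\in[0,\infty]$ be given by $$\frac1{c_A}=\inf\Big\{\frac{\|Ax\|}{\|x\|}\;:\;0\neq x\in D(A)\cap\overline{R(A^*)}\Big\},$$ and put $c_{0,\Gamma_0}:=c_{\operatorname{grad}_{\Gamma_0}}$ (Poincaré–Friedrichs constants)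 and $c_{1,\Gamma_0}:=c_{\operatorname{rot}_{\Gamma_0}}$ (Maxwell constants). Then: (1) $c_{0,\emptyset}=\frac1\pi$; $c_{0,\Gamma_b}=c_{0,\Gamma_t}=c_{0,\Gamma_l}=c_{0,\Gamma_r}=\frac2\pi$; $c_{0,\Gamma_{b,t}}=c_{0,\Gamma_{l,r}}=\frac1\pi$; $c_{0,\Gamma_{b,l}}=c_{0,\Gamma_{b,r}}=c_{0,\Gamma_{t,l}}=c_{0,\Gamma_{t,r}}=\frac{\sqrt2}\pi$; $c_{0,\Gamma_{b,l,r}}=c_{0,\Gamma_{t,l,r}}=c_{0,\Gamma_{b,t,l}}=c_{0,\Gamma_{b,t,r}}=\frac2{\sqrt5\,\pi}$; $c_{0,\Gamma}=\frac1{\sqrt2\,\pi}$. (2) For every set $S$ of sides, with $\Gamma_\tau=\Gamma_S$ and $\Gamma_\nu=\Gamma\setminus\overline{\Gamma_\tau}$, one has $c_{1,\Gamma_\nu}=c_{0,\Gamma_\tau}$. (3) Hence $c_{1,\emptyset}=\frac1{\sqrt2\,\pi}$; $c_{1,\Gamma_S}=\frac2{\sqrt5\,\pi}$ if $S$ is one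 side; $c_{1,\Gamma_S}=\frac1\pi$ if $S$ consists of two opposite sides; $c_{1,\Gamma_S}=\frac{\sqrt2}\pi$ if $S$ consists of two adjacent sides; $c_{1,\Gamma_S}=\frac2\pi$ if $S$ consists of three sides; $c_{1,\Gamma}=\frac1\pi$. -/

import Mathlib

open MeasureTheory Set
open scoped ENNReal ContDiff

noncomputable section

namespace UnitSquare

/-! ### Best constants of densely defined closed operators -/

/-- The domain of the reduced operator: `D(A) ∩ closure (R(A*))`. -/
def reducedDomain {E F : Type*} [NormedAddCommGroup E] [InnerProductSpace ℝ E] [CompleteSpace E]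
    [NormedAddCommGroup F] [InnerProductSpace ℝ F] (A : E →ₗ.[ℝ] F) : Set A.domain :=
  {x | (x : E) ∈ closure (Set.range A.adjoint)}

/-- The best constant `c_A ∈ [0, ∞]` of `A`, defined by
`1 / c_A = inf { ‖A x‖ / ‖x‖ : 0 ≠ x ∈ D(A) ∩ closure (R(A*)) }`. -/
def bestConstant {E F : Type*} [NormedAddCommGroup E] [InnerProductSpace ℝ E] [CompleteSpace E]
    [NormedAddCommGroup F] [InnerProductSpace ℝ F] (A : E →ₗ.[ℝ] F) : ℝ≥0∞ :=
  (⨅ (x : A.domain) (_ : x ∈ reducedDomain A) (_ : x ≠ 0), ‖A x‖ₑ / ‖(x : E)‖ₑ)⁻¹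

/-! ### The unit square and its boundary parts -/

/-- The Euclidean plane. -/
abbrev Plane : Type := EuclideanSpace ℝ (Fin 2)

/-- The open unit square `(0,1)²`. -/
def square : Set Plane := {x | x 0 ∈ Ioo (0 : ℝ) 1 ∧ x 1 ∈ Ioo (0 : ℝ) 1}

/-- The four sides: bottom, top, left, right. -/
inductive Side : Type
  | b
  | t
  | l
  | r

/-- The open (relative to the boundary, i.e. without corners) sides of the square. -/
def Side.toSet : Side → Set Plane
  | .b => {x | x 0 ∈ Ioo (0 : ℝ) 1 ∧ x 1 = 0}
  | .t => {x | x 0 ∈ Ioo (0 : ℝ) 1 ∧ x 1 = 1}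
  | .l => {x | x 0 = 0 ∧ x 1 ∈ Ioo (0 : ℝ) 1}
  | .r => {x | x 0 = 1 ∧ x 1 ∈ Ioo (0 : ℝ) 1}

/-- The boundary part made of the sides in `S`: the interior, relative to the boundary of the
square, of the closure of the union of these sides. -/
def boundaryPart (S : Set Side) : Set Plane :=
  {x | x ∈ frontier square ∧
    ∃ U : Set Plane, IsOpen U ∧ x ∈ U ∧ U ∩ frontier square ⊆ closure (⋃ s ∈ S, s.toSet)}

/-- The complementary boundary part `Γ \ closure Γ₀`. -/
def complPart (Γ₀ : Set Plane) : Set Plane := frontier square \ closure Γ₀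

/-! ### Test functions vanishing near a boundary part -/

/-- Smooth functions (or fields) on the plane with compact support at positive distance
from `Γ₀`. -/
structure IsTest {V : Type*} [NormedAddCommGroup V] [NormedSpace ℝ V] (Γ₀ : Set Plane)
    (φ : Plane → V) : Prop where
  smooth : ContDiff ℝ ∞ φ
  compact : HasCompactSupport φ
  away : ∃ δ > 0, ∀ x ∈ tsupport φ, ∀ y ∈ Γ₀, δ ≤ dist x y

theorem IsTest.zero {V : Type*} [NormedAddCommGroup V] [NormedSpace ℝ V] (Γ₀ : Set Plane) :
    IsTest Γ₀ (0 : Plane → V) :=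
  ⟨contDiff_const, HasCompactSupport.zero, 1, one_pos, by simp [tsupport]⟩

theorem IsTest.add {V : Type*} [NormedAddCommGroup V] [NormedSpace ℝ V] {Γ₀ : Set Plane}
    {φ ψ : Plane → V} (hφ : IsTest Γ₀ φ) (hψ : IsTest Γ₀ ψ) : IsTest Γ₀ (φ + ψ) := by
  obtain ⟨d, hd, h⟩ := hφ.away
  obtain ⟨e, he, k⟩ := hψ.away
  refine ⟨hφ.smooth.add hψ.smooth, hφ.compact.add hψ.compact, min d e, lt_min hd he, ?_⟩
  intro x hx y hy
  rcases tsupport_add φ ψ hx with hx | hx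
  · exact (min_le_left _ _).trans (h x hx y hy)
  · exact (min_le_right _ _).trans (k x hx y hy)

theorem IsTest.smul {V : Type*} [NormedAddCommGroup V] [NormedSpace ℝ V] {Γ₀ : Set Plane}
    {φ : Plane → V} (c : ℝ) (hφ : IsTest Γ₀ φ) : IsTest Γ₀ (c • φ) := by
  obtain ⟨d, hd, h⟩ := hφ.away
  have hs : Function.support (c • φ) ⊆ Function.support φ := by
    intro x hx hx0
    exact hx (by simp [hx0])
  exact ⟨contDiff_const.smul hφ.smooth, hφ.compact.mono hs, d, hd,
    fun x hx y hy => h x (closure_mono hs hx) y hy⟩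

theorem IsTest.differentiableAt {V : Type*} [NormedAddCommGroup V] [NormedSpace ℝ V]
    {Γ₀ : Set Plane} {φ : Plane → V} (hφ : IsTest Γ₀ φ) (x : Plane) : DifferentiableAt ℝ φ x :=
  hφ.smooth.contDiffAt.differentiableAt (by simp)

/-! ### The operators `grad` and `rot` with boundary conditions on a boundary part -/

/-- Lebesgue measure on the square. -/
abbrev vol : Measure Plane := volume.restrict square

/-- `L²` scalar functions on the square. -/
abbrev L2 : Type := Lp ℝ 2 vol

/-- `L²` vector fields on the square. -/
abbrev L2Vec : Type := Lp Plane 2 vol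

/-- The classical two-dimensional rotation `∂₁E₂ - ∂₂E₁` of a vector field. -/
def rot (E : Plane → Plane) (x : Plane) : ℝ :=
  (fderiv ℝ E x (EuclideanSpace.single 0 1)) 1 - (fderiv ℝ E x (EuclideanSpace.single 1 1)) 0

/-- The graph of the classical gradient on the restrictions to the square of scalar test
functions vanishing near `Γ₀`. -/
def gradGraph (Γ₀ : Set Plane) : Submodule ℝ (L2 × L2Vec) where
  carrier := {p | ∃ φ : Plane → ℝ, IsTest Γ₀ φ ∧ p.1 =ᵐ[vol] φ ∧ p.2 =ᵐ[vol] gradient φ}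
  zero_mem' := by
    refine ⟨0, IsTest.zero Γ₀, Lp.coeFn_zero _ _ _, (Lp.coeFn_zero _ _ _).trans ?_⟩
    filter_upwards with x
    simp [gradient]
  add_mem' := by
    rintro p q ⟨φ, hφ, h1, h2⟩ ⟨ψ, hψ, k1, k2⟩
    refine ⟨φ + ψ, hφ.add hψ, (Lp.coeFn_add _ _).trans (h1.add k1),
      (Lp.coeFn_add _ _).trans ((h2.add k2).trans ?_)⟩
    filter_upwards with x
    simp [gradient, fderiv_add (hφ.differentiableAt x) (hψ.differentiableAt x)]
  smul_mem' := by
    rintro c p ⟨φ, hφ, h1, h2⟩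
    refine ⟨c • φ, hφ.smul c, (Lp.coeFn_smul _ _).trans (h1.const_smul c),
      (Lp.coeFn_smul _ _).trans ((h2.const_smul c).trans ?_)⟩
    filter_upwards with x
    simp [gradient, fderiv_const_smul (hφ.differentiableAt x)]

/-- The graph of the classical rotation on the restrictions to the square of test vector fields
vanishing near `Γ₀`. -/
def rotGraph (Γ₀ : Set Plane) : Submodule ℝ (L2Vec × L2) where
  carrier := {p | ∃ Φ : Plane → Plane, IsTest Γ₀ Φ ∧ p.1 =ᵐ[vol] Φ ∧ p.2 =ᵐ[vol] rot Φ}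
  zero_mem' := by
    refine ⟨0, IsTest.zero Γ₀, Lp.coeFn_zero _ _ _, (Lp.coeFn_zero _ _ _).trans ?_⟩
    filter_upwards with x
    simp [rot]
  add_mem' := by
    rintro p q ⟨φ, hφ, h1, h2⟩ ⟨ψ, hψ, k1, k2⟩
    refine ⟨φ + ψ, hφ.add hψ, (Lp.coeFn_add _ _).trans (h1.add k1),
      (Lp.coeFn_add _ _).trans ((h2.add k2).trans ?_)⟩
    filter_upwards with x
    simp [rot, fderiv_add (hφ.differentiableAt x) (hψ.differentiableAt x)]
    ring
  smul_mem' := by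
    rintro c p ⟨φ, hφ, h1, h2⟩
    refine ⟨c • φ, hφ.smul c, (Lp.coeFn_smul _ _).trans (h1.const_smul c),
      (Lp.coeFn_smul _ _).trans ((h2.const_smul c).trans ?_)⟩
    filter_upwards with x
    simp [rot, fderiv_const_smul (hφ.differentiableAt x)]
    ring

/-! ### The graph closures are graphs of operators -/

theorem isOpen_square : IsOpen square := by
  have h : ∀ i : Fin 2, IsOpen {x : Plane | x i ∈ Ioo (0 : ℝ) 1} := fun i =>
    isOpen_Ioo.preimage (by fun_prop)
  exact (h 0).inter (h 1)

theorem continuous_pairing {V : Type*} [NormedAddCommGroup V] [InnerProductSpace ℝ V]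
    [FiniteDimensional ℝ V]
    {Ψ : Plane → V} (hc : Continuous Ψ) (hs : HasCompactSupport Ψ) :
    Continuous fun u : Lp V 2 vol => ∫ x, inner ℝ (Ψ x) (u x) ∂vol := by
  have hm : MemLp Ψ 2 vol := (hc.memLp_of_hasCompactSupport hs)
  have : (fun u : Lp V 2 vol => ∫ x, inner ℝ (Ψ x) (u x) ∂vol) =
      fun u => inner ℝ (hm.toLp Ψ) u := by
    ext u
    rw [L2.inner_def]
    refine integral_congr_ae ?_
    filter_upwards [hm.coeFn_toLp] with x hx
    rw [hx]
  rw [this]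
  fun_prop

theorem integral_parts {φ ψ : Plane → ℝ} (hφ : ContDiff ℝ ∞ φ) (hφc : HasCompactSupport φ)
    (hψ : ContDiff ℝ ∞ ψ) (hψc : HasCompactSupport ψ) (hψs : tsupport ψ ⊆ square) (v : Plane) :
    ∫ x, ψ x * fderiv ℝ φ x v ∂vol = - ∫ x, fderiv ℝ ψ x v * φ x ∂vol := by
  have hd : Continuous fun x => fderiv ℝ φ x v :=
    (hφ.continuous_fderiv (by simp)).clm_apply continuous_const
  have hd' : Continuous fun x => fderiv ℝ ψ x v :=
    (hψ.continuous_fderiv (by simp)).clm_apply continuous_const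
  rw [setIntegral_eq_integral_of_forall_compl_eq_zero,
    setIntegral_eq_integral_of_forall_compl_eq_zero]
  · refine integral_mul_fderiv_eq_neg_fderiv_mul_of_integrable ?_ ?_ ?_
      (fun x _ => hψ.differentiable (by simp) x) (fun x _ => hφ.differentiable (by simp) x)
    · exact (hd'.mul hφ.continuous).integrable_of_hasCompactSupport hφc.mul_left
    · exact (hψ.continuous.mul hd).integrable_of_hasCompactSupport hψc.mul_right
    · exact (hψ.continuous.mul hφ.continuous).integrable_of_hasCompactSupport hψc.mul_right
  · intro x hx
    have : fderiv ℝ ψ x = 0 :=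
      image_eq_zero_of_notMem_tsupport fun h => hx (hψs (tsupport_fderiv_subset ℝ h))
    simp [this]
  · intro x hx
    have : ψ x = 0 := image_eq_zero_of_notMem_tsupport fun h => hx (hψs h)
    simp [this]

theorem ae_zero_of_pairing {f : Plane → ℝ} (hf : MemLp f 2 vol)
    (h : ∀ ψ : Plane → ℝ, ContDiff ℝ ∞ ψ → HasCompactSupport ψ → tsupport ψ ⊆ square →
      ∫ x, ψ x * f x ∂vol = 0) : f =ᵐ[vol] 0 := by
  have hl : LocallyIntegrableOn f square volume :=
    locallyIntegrableOn_of_locallyIntegrable_restrict (hf.locallyIntegrable (by norm_num))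
  have := isOpen_square.ae_eq_zero_of_integral_contDiff_smul_eq_zero hl (fun g hg hgc hgs => by
    rw [← h g hg hgc hgs, setIntegral_eq_integral_of_forall_compl_eq_zero]
    · rfl
    · intro x hx
      simp [image_eq_zero_of_notMem_tsupport fun h => hx (hgs h)])
  exact (ae_restrict_iff' isOpen_square.measurableSet).2 this

theorem gradGraph_isGraph (Γ₀ : Set Plane) :
    ∀ p ∈ (gradGraph Γ₀).topologicalClosure, p.1 = 0 → p.2 = 0 := by
  intro p hp h0
  have key : ∀ (i : Fin 2) (ψ : Plane → ℝ), ContDiff ℝ ∞ ψ → HasCompactSupport ψ →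
      tsupport ψ ⊆ square → ∫ x, ψ x * p.2 x i ∂vol = 0 := by
    intro i ψ hψ hψc hψs
    have hd' : Continuous fun x => fderiv ℝ ψ x (EuclideanSpace.single i 1) :=
      (hψ.continuous_fderiv (by simp)).clm_apply continuous_const
    have hsd : HasCompactSupport fun x => fderiv ℝ ψ x (EuclideanSpace.single i 1) :=
      hψc.fderiv_apply ℝ _
    have c1 := (continuous_pairing hd' hsd).comp (continuous_fst : Continuous (Prod.fst : L2 × L2Vec → L2))
    have hΨ : Continuous fun x => ψ x • (EuclideanSpace.single i 1 : Plane) :=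
      hψ.continuous.smul continuous_const
    have c2 := (continuous_pairing hΨ hψc.smul_right).comp
      (continuous_snd : Continuous (Prod.snd : L2 × L2Vec → L2Vec))
    have hcl : IsClosed {q : L2 × L2Vec | _ = _} := isClosed_eq c2 c1.neg
    have hq := closure_minimal (s := (gradGraph Γ₀ : Set (L2 × L2Vec))) (fun q hq => ?_) hcl hp
    · have hz : ∫ x, inner ℝ (fderiv ℝ ψ x (EuclideanSpace.single i 1)) (p.1 x) ∂vol = 0 := by
        rw [h0]
        refine integral_eq_zero_of_ae ?_
        filter_upwards [Lp.coeFn_zero ℝ 2 vol] with x hx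
        simp only [hx, Pi.zero_apply, inner_zero_right]
      simp only [Set.mem_ofPred_eq, Function.comp_apply] at hq
      simp only [Pi.neg_apply, Function.comp_apply, hz] at hq
      simpa [real_inner_smul_left, EuclideanSpace.inner_single_left] using hq
    · obtain ⟨φ, hφ, h1, h2⟩ := hq
      have := integral_parts hφ.smooth hφ.compact hψ hψc hψs (EuclideanSpace.single i 1)
      simp only [Set.mem_ofPred_eq, Function.comp_apply]
      refine Eq.trans (integral_congr_ae ?_) (this.trans (congrArg _ (integral_congr_ae ?_)))
      · filter_upwards [h2] with x hx
        rw [hx, real_inner_smul_left, real_inner_comm, gradient,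
          InnerProductSpace.toDual_symm_apply]
      · filter_upwards [h1] with x hx
        rw [hx]
        simp [mul_comm]
  have hz : ∀ i : Fin 2, (fun x => p.2 x i) =ᵐ[vol] 0 := fun i =>
    ae_zero_of_pairing ((EuclideanSpace.proj (𝕜 := ℝ) i).comp_memLp' (Lp.memLp p.2)) (key i)
  refine (Lp.eq_zero_iff_ae_eq_zero).2 ?_
  filter_upwards [hz 0, hz 1] with x h1 h2
  ext i
  fin_cases i
  · exact h1
  · exact h2

theorem rotGraph_isGraph (Γ₀ : Set Plane) :
    ∀ p ∈ (rotGraph Γ₀).topologicalClosure, p.1 = 0 → p.2 = 0 := by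
  intro p hp h0
  refine (Lp.eq_zero_iff_ae_eq_zero).2 (ae_zero_of_pairing (Lp.memLp p.2) ?_)
  intro ψ hψ hψc hψs
  have hd (v : Plane) : Continuous fun x => fderiv ℝ ψ x v :=
    (hψ.continuous_fderiv (by simp)).clm_apply continuous_const
  have hsd (v : Plane) : HasCompactSupport fun x => fderiv ℝ ψ x v := hψc.fderiv_apply ℝ _
  let e (i : Fin 2) : Plane := EuclideanSpace.single i 1
  let Ψ : Plane → Plane := fun x => fderiv ℝ ψ x (e 1) • e 0 - fderiv ℝ ψ x (e 0) • e 1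
  have hΨ : Continuous Ψ := ((hd _).smul continuous_const).sub ((hd _).smul continuous_const)
  have hΨc : HasCompactSupport Ψ := (hsd _).smul_right.sub (hsd _).smul_right
  have c1 := (continuous_pairing hΨ hΨc).comp
    (continuous_fst : Continuous (Prod.fst : L2Vec × L2 → L2Vec))
  have c2 := (continuous_pairing hψ.continuous hψc).comp
    (continuous_snd : Continuous (Prod.snd : L2Vec × L2 → L2))
  have hcl : IsClosed {q : L2Vec × L2 | _ = _} := isClosed_eq c2 c1
  have hq := closure_minimal (s := (rotGraph Γ₀ : Set (L2Vec × L2))) (fun q hq => ?_) hcl hp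
  · have hz : ∫ x, inner ℝ (Ψ x) (p.1 x) ∂vol = 0 := by
      rw [h0]
      refine integral_eq_zero_of_ae ?_
      filter_upwards [Lp.coeFn_zero Plane 2 vol] with x hx
      simp only [hx, Pi.zero_apply, inner_zero_right]
    simp only [Set.mem_ofPred_eq, Function.comp_apply] at hq
    rw [hz] at hq
    simpa [mul_comm] using hq
  · obtain ⟨Φ, hΦ, h1, h2⟩ := hq
    have hcomp (i : Fin 2) : ContDiff ℝ ∞ fun x => Φ x i :=
      (EuclideanSpace.proj (𝕜 := ℝ) i).contDiff.comp hΦ.smooth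
    have hcs (i : Fin 2) : HasCompactSupport fun x => Φ x i :=
      hΦ.compact.comp_left (g := fun y : Plane => y i) rfl
    have hfd (i : Fin 2) (v x : Plane) : fderiv ℝ (fun x => Φ x i) x v = fderiv ℝ Φ x v i := by
      have := ((EuclideanSpace.proj i : Plane →L[ℝ] ℝ).hasFDerivAt.comp x
        (hΦ.differentiableAt x).hasFDerivAt).fderiv
      exact congrArg (fun L => L v) this
    have p1 := integral_parts (hcomp 1) (hcs 1) hψ hψc hψs (e 0)
    have p0 := integral_parts (hcomp 0) (hcs 0) hψ hψc hψs (e 1)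
    have hcd (i : Fin 2) (v : Plane) : Continuous fun x => fderiv ℝ (fun x => Φ x i) x v :=
      ((hcomp i).continuous_fderiv (by simp)).clm_apply continuous_const
    have i1 (i : Fin 2) (v : Plane) :
        Integrable (fun x => ψ x * fderiv ℝ (fun x => Φ x i) x v) vol :=
      ((hψ.continuous.mul (hcd i v)).integrable_of_hasCompactSupport hψc.mul_right)
    have i2 (i : Fin 2) (v : Plane) :
        Integrable (fun x => fderiv ℝ ψ x v * Φ x i) vol :=
      (((hd v).mul (hcomp i).continuous).integrable_of_hasCompactSupport (hsd v).mul_right)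
    simp only [Set.mem_ofPred_eq, Function.comp_apply]
    have l : ∫ x, inner ℝ (ψ x) (q.2 x) ∂vol =
        ∫ x, (ψ x * fderiv ℝ (fun x => Φ x 1) x (e 0) -
          ψ x * fderiv ℝ (fun x => Φ x 0) x (e 1)) ∂vol := by
      refine integral_congr_ae ?_
      filter_upwards [h2] with x hx
      rw [hx, hfd, hfd]
      simp only [rot, e, RCLike.inner_apply, conj_trivial]
      ring
    have r : ∫ x, inner ℝ (Ψ x) (q.1 x) ∂vol =
        ∫ x, (fderiv ℝ ψ x (e 1) * Φ x 0 - fderiv ℝ ψ x (e 0) * Φ x 1) ∂vol := by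
      refine integral_congr_ae ?_
      filter_upwards [h1] with x hx
      rw [hx]
      simp only [Ψ, e, inner_sub_left, real_inner_smul_left, EuclideanSpace.inner_single_left]
      simp
    rw [l, r, integral_sub (i1 _ _) (i1 _ _), integral_sub (i2 _ _) (i2 _ _), p1, p0]
    ring

/-- The gradient with homogeneous boundary condition on `Γ₀`: the unbounded operator
`L² → L²` whose graph is the closure of the graph of the classical gradient. -/
def gradOp (Γ₀ : Set Plane) : L2 →ₗ.[ℝ] L2Vec := (gradGraph Γ₀).topologicalClosure.toLinearPMap

/-- The rotation with homogeneous tangential boundary condition on `Γ₀`: the unbounded operator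
`L² → L²` whose graph is the closure of the graph of the classical rotation. -/
def rotOp (Γ₀ : Set Plane) : L2Vec →ₗ.[ℝ] L2 := (rotGraph Γ₀).topologicalClosure.toLinearPMap

/-- The Poincaré–Friedrichs (Laplace) constant `c_{0,Γ₀}` of the unit square. -/
def c₀ (Γ₀ : Set Plane) : ℝ≥0∞ := bestConstant (gradOp Γ₀)

/-- The Maxwell constant `c_{1,Γ₀}` of the unit square. -/
def c₁ (Γ₀ : Set Plane) : ℝ≥0∞ := bestConstant (rotOp Γ₀)

end UnitSquare

end

noncomputable section

namespace UnitSquare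

open Filter Topology

/-! ### Best constants of operators diagonalised by an orthogonal family -/

section Abstract

variable {E F ι : Type*} [NormedAddCommGroup E] [InnerProductSpace ℝ E]
  [NormedAddCommGroup F] [InnerProductSpace ℝ F]

/-! Separate variables. For a set `S` of sides, `eigenfun S n` is a product of sine modes with
Dirichlet conditions on the sides in `S` and Neumann conditions on the others. In each direction the
frequency is π(j + d/2), where d is the number of Dirichlet ends in that direction. The product e is
therefore an eigenfunction of the negative Laplacian, with eigenvalue λ² for λ = `eigenroot S n`,
and these functions form a complete orthogonal family in L².

The gradient with boundary condition on `S` maps e to ∇e, and its adjoint maps ∇e to λ² e. For the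
rotation with boundary condition on the complementary sides, the adjoint maps e to the rotated
gradient `curl e`, and rot (curl e) = λ² e. Here `curl e` is admissible because its tangential
component is, up to sign, the normal derivative of e, which vanishes on the Neumann sides. So the
same functions diagonalise the gradient in its initial space and the rotation in its target space,
and both best constants equal 1/λ for the smallest nonzero λ (`bestConstant_of_orthogonal`,
`bestConstant_of_orthogonal_adjoint`). This gives the identity between Maxwell and
Poincaré–Friedrichs constants, and the values are read off from the lowest mode.

Two points need work. Both operators are closures from test functions vanishing near the boundary
part, so e and `curl e` must be approximated by such functions: they are pulled back along the maps
`clampMap n`, which collapse a strip along each side onto that side (`IsPart.mem_gradOp`,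
`IsPart.mem_rotOp`). Completeness (`eq_zero_of_integral_eigenfun`) follows from Stone–Weierstrass,
because multiplication by cos(πxᵢ) preserves the span of the modes. The adjoints enter only through
integration by parts against test functions; neither compact embeddings nor regularity theory is
used. -/

theorem mem_adjoint_graph_iff [CompleteSpace E] {A : E →ₗ.[ℝ] F}
    (hA : Dense (A.domain : Set E)) {y : F} {w : E} :
    (y, w) ∈ A.adjoint.graph ↔ ∀ p ∈ A.graph, inner ℝ p.2 y = inner ℝ p.1 w := by
  rw [LinearPMap.adjoint_graph_eq_graph_adjoint hA, Submodule.mem_adjoint_iff]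
  simp only [sub_eq_zero, Prod.forall]

theorem mem_range_adjoint [CompleteSpace E] {A : E →ₗ.[ℝ] F} {y : F} {w : E}
    (h : (y, w) ∈ A.adjoint.graph) : w ∈ Set.range A.adjoint := by
  obtain ⟨z, -, hz⟩ := (LinearPMap.mem_graph_iff _).1 h
  exact ⟨z, hz⟩

/-- The best constant is determined by a lower bound on the reduced domain which is attained. -/
theorem bestConstant_eq [CompleteSpace E] {A : E →ₗ.[ℝ] F} {μ : ℝ} (hμ : 0 < μ)
    (hlow : ∀ p ∈ A.graph, p.1 ∈ closure (Set.range A.adjoint) → μ * ‖p.1‖ ≤ ‖p.2‖)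
    {p : E × F} (hp : p ∈ A.graph) (hpr : p.1 ∈ closure (Set.range A.adjoint)) (hp0 : p.1 ≠ 0)
    (hatt : ‖p.2‖ ≤ μ * ‖p.1‖) : bestConstant A = ENNReal.ofReal (1 / μ) := by
  have key : (⨅ (x : A.domain) (_ : x ∈ reducedDomain A) (_ : x ≠ 0), ‖A x‖ₑ / ‖(x : E)‖ₑ)
      = ENNReal.ofReal μ := by
    refine le_antisymm ?_ (le_iInf fun x => le_iInf fun hx => le_iInf fun hx0 => ?_)
    · obtain ⟨z, hz, hz2⟩ := (LinearPMap.mem_graph_iff _).1 hp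
      have hzr : z ∈ reducedDomain A := by
        change (z : E) ∈ closure _
        rwa [hz]
      have hz0 : z ≠ 0 := by
        rintro rfl
        exact hp0 (by simpa using hz.symm)
      refine iInf_le_of_le z (iInf₂_le_of_le hzr hz0 ?_)
      refine ENNReal.div_le_of_le_mul ?_
      rw [hz, hz2, ← ofReal_norm, ← ofReal_norm, ← ENNReal.ofReal_mul hμ.le]
      exact ENNReal.ofReal_le_ofReal hatt
    · have hx0' : (x : E) ≠ 0 := fun h => hx0 (Subtype.ext h)
      rw [ENNReal.le_div_iff_mul_le (Or.inl (by simpa using hx0')) (Or.inl (by simp)),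
        ← ofReal_norm, ← ofReal_norm, ← ENNReal.ofReal_mul hμ.le]
      exact ENNReal.ofReal_le_ofReal (hlow (x, A x) (A.mem_graph x) hx)
  rw [bestConstant, key, one_div, ENNReal.ofReal_inv_of_pos hμ]

/-- Bessel's inequality for the images of an orthonormal system of eigenvectors. -/
theorem bessel_of_singular {G : Submodule ℝ (E × F)} {b : ι → E} {v : ι → F} {lam : ι → ℝ}
    (hb : Orthonormal ℝ b) (h1 : ∀ i, (b i, v i) ∈ G)
    (h2 : ∀ i, ∀ p ∈ G, inner ℝ p.2 (v i) = lam i ^ 2 * inner ℝ p.1 (b i))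
    {μ : ℝ} (hμ : 0 < μ) (hmin : ∀ i, lam i ≠ 0 → μ ≤ lam i) {p : E × F} (hp : p ∈ G)
    {s : Finset ι} (hs : ∀ i ∈ s, lam i ≠ 0) :
    μ ^ 2 * ∑ i ∈ s, inner ℝ p.1 (b i) ^ 2 ≤ ‖p.2‖ ^ 2 := by
  classical
  -- By `h2`, ⟨v i, v j⟩ = lam j ² ⟨b i, b j⟩, so the `v i` are orthogonal with norm |lam i|.
  -- Ordinary Bessel for the normalised images, applied to `p.2`, has coefficients lam i ⟨p.1, b i⟩.
  have hw : Orthonormal ℝ fun i : {i // lam i ≠ 0} => (lam i)⁻¹ • v i := by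
    rw [orthonormal_iff_ite] at hb ⊢
    rintro ⟨i, hi⟩ ⟨j, hj⟩
    rw [real_inner_smul_left, real_inner_smul_right, h2 j _ (h1 i), hb]
    by_cases h : i = j
    · subst h
      simp
      field_simp
    · simp [h]
  have := hw.sum_inner_products_le (s := s.subtype fun i => lam i ≠ 0) p.2
  refine le_trans ?_ this
  rw [Finset.sum_subtype_of_mem (fun i => ‖inner ℝ ((lam i)⁻¹ • v i) p.2‖ ^ 2) hs, Finset.mul_sum]
  refine Finset.sum_le_sum fun i hi => ?_
  have hi0 := hs i hi
  have h := hmin i hi0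
  rw [real_inner_smul_left, real_inner_comm p.2, h2 i p hp, Real.norm_eq_abs, sq_abs]
  have : (lam i)⁻¹ * (lam i ^ 2 * inner ℝ p.1 (b i)) = lam i * inner ℝ p.1 (b i) := by
    field_simp
  rw [this, mul_pow]
  gcongr

/-- An operator diagonalised by an orthonormal basis of its initial space. -/
theorem bestConstant_of_hilbertBasis [CompleteSpace E] {A : E →ₗ.[ℝ] F}
    (hA : Dense (A.domain : Set E))
    (b : HilbertBasis ι ℝ E) {v : ι → F} {lam : ι → ℝ} (h1 : ∀ i, (b i, v i) ∈ A.graph)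
    (h2 : ∀ i, (v i, lam i ^ 2 • b i) ∈ A.adjoint.graph)
    {i₀ : ι} (hpos : 0 < lam i₀) (hmin : ∀ i, lam i ≠ 0 → lam i₀ ≤ lam i) :
    bestConstant A = ENNReal.ofReal (1 / lam i₀) := by
  have h2' : ∀ i, ∀ p ∈ A.graph, inner ℝ p.2 (v i) = lam i ^ 2 * inner ℝ p.1 (b i) := by
    intro i p hp
    rw [(mem_adjoint_graph_iff hA).1 (h2 i) p hp, real_inner_smul_right]
  have hnv : ∀ i, ‖v i‖ ^ 2 = lam i ^ 2 := by
    intro i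
    rw [← real_inner_self_eq_norm_sq, h2' i _ (h1 i), real_inner_self_eq_norm_sq,
      b.orthonormal.1 i]
    ring
  refine bestConstant_eq hpos ?_ (h1 i₀) ?_ (b.orthonormal.ne_zero i₀) ?_
  · intro p hp hcl
    -- A zero singular value forces `v i = 0`, so `b i` lies in the kernel of `A` and is orthogonal
    -- to the range of the adjoint. Only nonzero singular values then survive in Parseval's identity
    -- for `p.1`.
    have hker : ∀ i, lam i = 0 → inner ℝ p.1 (b i) = 0 := by
      intro i hi
      have hv : v i = 0 := by
        have := hnv i
        rw [hi] at this
        simpa using this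
      have hclosed : IsClosed {x : E | inner ℝ x (b i) = 0} :=
        isClosed_eq (by fun_prop) continuous_const
      refine closure_minimal ?_ hclosed hcl
      rintro _ ⟨y, rfl⟩
      have := (mem_adjoint_graph_iff hA).1 (A.adjoint.mem_graph y) _ (h1 i)
      simp only [hv, inner_zero_left] at this
      change inner ℝ _ _ = 0
      rw [real_inner_comm, ← this]
    have hsum : lam i₀ ^ 2 * ‖p.1‖ ^ 2 ≤ ‖p.2‖ ^ 2 := by
      have hs := (b.hasSum_inner_mul_inner p.1 p.1).mul_left (lam i₀ ^ 2)
      rw [real_inner_self_eq_norm_sq] at hs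
      refine le_of_tendsto' hs fun s => ?_
      classical
      rw [← Finset.mul_sum]
      have := bessel_of_singular b.orthonormal h1 h2' hpos hmin hp
        (s := s.filter fun i => lam i ≠ 0) (by simp)
      refine le_trans (le_of_eq ?_) this
      congr 1
      rw [Finset.sum_filter]
      refine Finset.sum_congr rfl fun i _ => ?_
      split_ifs with h
      · rw [real_inner_comm p.1 (b i)]
        ring
      · rw [hker i (not_not.1 h)]
        ring
    rw [← mul_pow] at hsum
    exact (sq_le_sq₀ (by positivity) (norm_nonneg _)).1 hsum
  · refine subset_closure ?_
    have := A.adjoint.graph.smul_mem (lam i₀ ^ 2)⁻¹ (h2 i₀)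
    refine mem_range_adjoint (y := (lam i₀ ^ 2)⁻¹ • v i₀) ?_
    convert this using 1
    simp [smul_smul, hpos.ne']
  · rw [b.orthonormal.1 i₀, mul_one]
    exact ((sq_eq_sq₀ (norm_nonneg _) hpos.le).1 (hnv i₀)).le

/-- An operator diagonalised by an orthonormal basis of its target space. -/
theorem bestConstant_of_hilbertBasis_adjoint [CompleteSpace E] {A : E →ₗ.[ℝ] F}
    (hA : Dense (A.domain : Set E))
    (b : HilbertBasis ι ℝ F) {w : ι → E} {lam : ι → ℝ} (h1 : ∀ i, (b i, w i) ∈ A.adjoint.graph)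
    (h2 : ∀ i, (w i, lam i ^ 2 • b i) ∈ A.graph)
    {i₀ : ι} (hpos : 0 < lam i₀) (hmin : ∀ i, lam i ≠ 0 → lam i₀ ≤ lam i) :
    bestConstant A = ENNReal.ofReal (1 / lam i₀) := by
  have hadj : ∀ p ∈ A.graph, ∀ q ∈ A.adjoint.graph, inner ℝ p.2 q.1 = inner ℝ p.1 q.2 :=
    fun p hp q hq => (mem_adjoint_graph_iff hA).1 hq p hp
  have h2' : ∀ i, ∀ q ∈ A.adjoint.graph,
      inner ℝ q.2 (w i) = lam i ^ 2 * inner ℝ q.1 (b i) := by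
    intro i q hq
    rw [real_inner_comm, ← hadj _ (h2 i) q hq, real_inner_smul_left, real_inner_comm]
  have hnw : ∀ i, ‖w i‖ ^ 2 = lam i ^ 2 := by
    intro i
    rw [← real_inner_self_eq_norm_sq, h2' i _ (h1 i), real_inner_self_eq_norm_sq,
      b.orthonormal.1 i]
    ring
  have hnw0 : ‖w i₀‖ = lam i₀ := (sq_eq_sq₀ (norm_nonneg _) hpos.le).1 (hnw i₀)
  refine bestConstant_eq hpos ?_ (h2 i₀) (subset_closure (mem_range_adjoint (h1 i₀))) ?_ ?_
  · intro p hp hcl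
    -- Duality: ⟨p.1, A* q⟩ = ⟨A p.1, q⟩ is expanded in the basis `b` and estimated by
    -- Cauchy–Schwarz, with Bessel for `p.2` and the singular Bessel inequality for A* q.
    have key : ∀ q ∈ A.adjoint.graph, lam i₀ * inner ℝ p.1 q.2 ≤ ‖p.2‖ * ‖q.2‖ := by
      intro q hq
      rw [← hadj p hp q hq]
      have hs := (b.hasSum_inner_mul_inner p.2 q.1).mul_left (lam i₀)
      refine le_of_tendsto' hs fun s => ?_
      classical
      rw [← Finset.mul_sum]
      have hz : ∑ i ∈ s, inner ℝ p.2 (b i) * inner ℝ (b i) q.1 =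
          ∑ i ∈ s with lam i ≠ 0, inner ℝ p.2 (b i) * inner ℝ (b i) q.1 := by
        rw [Finset.sum_filter]
        refine Finset.sum_congr rfl fun i _ => ?_
        split_ifs with h
        · rfl
        · have hw : w i = 0 := by
            have := hnw i
            rw [not_not.1 h] at this
            simpa using this
          rw [hadj p hp _ (h1 i), hw]
          simp
      rw [hz]
      set t := s.filter fun i => lam i ≠ 0 with ht
      have hB := bessel_of_singular b.orthonormal h1 h2' hpos hmin hq (s := t) (by simp [ht])
      have hC : ∑ i ∈ t, inner ℝ p.2 (b i) ^ 2 ≤ ‖p.2‖ ^ 2 := by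
        refine le_trans (le_of_eq ?_) (b.orthonormal.sum_inner_products_le (s := t) p.2)
        refine Finset.sum_congr rfl fun i _ => ?_
        rw [Real.norm_eq_abs, sq_abs, real_inner_comm]
      have hCS := Finset.sum_mul_sq_le_sq_mul_sq t (fun i => inner ℝ p.2 (b i))
        (fun i => inner ℝ (b i) q.1)
      simp only [real_inner_comm q.1] at hCS
      refine abs_le_of_sq_le_sq' ?_ (by positivity) |>.2
      calc _ = lam i₀ ^ 2 * (∑ i ∈ t, inner ℝ p.2 (b i) * inner ℝ q.1 (b i)) ^ 2 := by
            simp only [real_inner_comm q.1]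
            ring
        _ ≤ lam i₀ ^ 2 * ((∑ i ∈ t, inner ℝ p.2 (b i) ^ 2) * ∑ i ∈ t, inner ℝ q.1 (b i) ^ 2) := by
            gcongr
        _ = (∑ i ∈ t, inner ℝ p.2 (b i) ^ 2) * (lam i₀ ^ 2 * ∑ i ∈ t, inner ℝ q.1 (b i) ^ 2) := by
            ring
        _ ≤ ‖p.2‖ ^ 2 * ‖q.2‖ ^ 2 := by
            gcongr
        _ = _ := by ring
    have hclosed : IsClosed {x : E | lam i₀ * inner ℝ p.1 x ≤ ‖p.2‖ * ‖x‖} :=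
      isClosed_le (by fun_prop) (by fun_prop)
    -- The estimate extends from the range of the adjoint to its closure, hence to `p.1` itself,
    -- where it reads lam i₀ ‖p.1‖² ≤ ‖p.2‖ ‖p.1‖.
    have hx := closure_minimal (s := Set.range A.adjoint) (by
      rintro _ ⟨y, rfl⟩
      exact key _ (A.adjoint.mem_graph y)) hclosed hcl
    simp only [Set.mem_ofPred_eq, real_inner_self_eq_norm_sq] at hx
    by_cases h0 : ‖p.1‖ = 0
    · rw [h0]
      simp
    · have : 0 < ‖p.1‖ := lt_of_le_of_ne (norm_nonneg _) (Ne.symm h0)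
      refine le_of_mul_le_mul_right ?_ this
      linarith [hx, sq (‖p.1‖)]
  · intro h
    simp only at h
    rw [h, norm_zero] at hnw0
    exact hpos.ne hnw0
  · rw [norm_smul, hnw0, b.orthonormal.1 i₀]
    simp
    exact (sq _).le

/-- Normalisation of a complete orthogonal family. -/
theorem exists_hilbertBasis_of_orthogonal [CompleteSpace E] {e : ι → E} (he0 : ∀ i, e i ≠ 0)
    (horth : ∀ i j, i ≠ j → inner ℝ (e i) (e j) = 0)
    (htot : ∀ x : E, (∀ i, inner ℝ (e i) x = 0) → x = 0) :
    ∃ b : HilbertBasis ι ℝ E, ∀ i, b i = ‖e i‖⁻¹ • e i := by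
  have hon : Orthonormal ℝ fun i => ‖e i‖⁻¹ • e i := by
    refine ⟨fun i => ?_, fun i j hij => ?_⟩
    · rw [norm_smul, norm_inv, norm_norm, inv_mul_cancel₀ (norm_ne_zero_iff.2 (he0 i))]
    · change inner ℝ (‖e i‖⁻¹ • e i) (‖e j‖⁻¹ • e j) = 0
      rw [real_inner_smul_left, real_inner_smul_right, horth i j hij]
      simp
  have hbot : (Submodule.span ℝ (Set.range fun i => ‖e i‖⁻¹ • e i))ᗮ = ⊥ := by
    rw [Submodule.eq_bot_iff]
    intro x hx
    refine htot x fun i => ?_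
    have := (Submodule.mem_orthogonal _ _).1 hx _ (Submodule.subset_span ⟨i, rfl⟩)
    rw [real_inner_smul_left] at this
    exact (mul_eq_zero.1 this).resolve_left (inv_ne_zero (norm_ne_zero_iff.2 (he0 i)))
  exact ⟨HilbertBasis.mkOfOrthogonalEqBot hon hbot, fun i => by
    rw [HilbertBasis.coe_mkOfOrthogonalEqBot]⟩

/-- An operator diagonalised by a complete orthogonal family in its initial space. -/
theorem bestConstant_of_orthogonal [CompleteSpace E] {A : E →ₗ.[ℝ] F}
    (hA : Dense (A.domain : Set E)) {e : ι → E} (he0 : ∀ i, e i ≠ 0)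
    (horth : ∀ i j, i ≠ j → inner ℝ (e i) (e j) = 0)
    (htot : ∀ x : E, (∀ i, inner ℝ (e i) x = 0) → x = 0)
    {v : ι → F} {lam : ι → ℝ} (h1 : ∀ i, (e i, v i) ∈ A.graph)
    (h2 : ∀ i, (v i, lam i ^ 2 • e i) ∈ A.adjoint.graph)
    {i₀ : ι} (hpos : 0 < lam i₀) (hmin : ∀ i, lam i ≠ 0 → lam i₀ ≤ lam i) :
    bestConstant A = ENNReal.ofReal (1 / lam i₀) := by
  obtain ⟨b, hb⟩ := exists_hilbertBasis_of_orthogonal he0 horth htot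
  refine bestConstant_of_hilbertBasis hA b (v := fun i => ‖e i‖⁻¹ • v i) (fun i => ?_)
    (fun i => ?_) hpos hmin
  · rw [hb]
    exact A.graph.smul_mem _ (h1 i)
  · rw [hb, smul_comm]
    exact A.adjoint.graph.smul_mem _ (h2 i)

/-- An operator diagonalised by a complete orthogonal family in its target space. -/
theorem bestConstant_of_orthogonal_adjoint [CompleteSpace E] [CompleteSpace F] {A : E →ₗ.[ℝ] F}
    (hA : Dense (A.domain : Set E)) {e : ι → F} (he0 : ∀ i, e i ≠ 0)
    (horth : ∀ i j, i ≠ j → inner ℝ (e i) (e j) = 0)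
    (htot : ∀ x : F, (∀ i, inner ℝ (e i) x = 0) → x = 0)
    {w : ι → E} {lam : ι → ℝ} (h1 : ∀ i, (e i, w i) ∈ A.adjoint.graph)
    (h2 : ∀ i, (w i, lam i ^ 2 • e i) ∈ A.graph)
    {i₀ : ι} (hpos : 0 < lam i₀) (hmin : ∀ i, lam i ≠ 0 → lam i₀ ≤ lam i) :
    bestConstant A = ENNReal.ofReal (1 / lam i₀) := by
  obtain ⟨b, hb⟩ := exists_hilbertBasis_of_orthogonal he0 horth htot
  refine bestConstant_of_hilbertBasis_adjoint hA b (w := fun i => ‖e i‖⁻¹ • w i) (fun i => ?_)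
    (fun i => ?_) hpos hmin
  · rw [hb]
    exact A.adjoint.graph.smul_mem _ (h1 i)
  · rw [hb, smul_comm]
    exact A.graph.smul_mem _ (h2 i)

end Abstract

/-! ### Geometry of the boundary parts -/

/-- The coordinate which is constant along a side. -/
def Side.axis : Side → Fin 2
  | .b => 1
  | .t => 1
  | .l => 0
  | .r => 0

/-- The value of the constant coordinate along a side. -/
def Side.level : Side → ℝ
  | .b => 0
  | .t => 1
  | .l => 0
  | .r => 1

/-- The closed unit square. -/
def closedSquare : Set Plane := {x | ∀ i, x i ∈ Icc (0 : ℝ) 1}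

/-- The closed sides, including corners. -/
def Side.closed (s : Side) : Set Plane := {x | x ∈ closedSquare ∧ x s.axis = s.level}

theorem mem_square_iff {x : Plane} : x ∈ square ↔ ∀ i, x i ∈ Ioo (0 : ℝ) 1 := by
  simp [square, Fin.forall_fin_two]

theorem Side.mem_toSet_iff {s : Side} {x : Plane} :
    x ∈ s.toSet ↔ x s.axis = s.level ∧ ∀ i, i ≠ s.axis → x i ∈ Ioo (0 : ℝ) 1 := by
  cases s <;> simp [Side.toSet, Side.axis, Side.level, Fin.forall_fin_two, and_comm]

theorem Side.level_mem (s : Side) : s.level ∈ Icc (0 : ℝ) 1 := by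
  cases s <;> simp [Side.level]

theorem isClosed_closedSquare : IsClosed closedSquare := by
  simp only [closedSquare, ofPred_forall]
  exact isClosed_iInter fun i => isClosed_Icc.preimage (by fun_prop)

theorem Side.isClosed_closed (s : Side) : IsClosed s.closed :=
  isClosed_closedSquare.inter (isClosed_eq (by fun_prop) continuous_const)

theorem square_subset_closedSquare : square ⊆ closedSquare := fun _ hx i =>
  Ioo_subset_Icc_self (mem_square_iff.1 hx i)

theorem Side.toSet_subset_closed (s : Side) : s.toSet ⊆ s.closed := by
  intro x hx
  obtain ⟨h1, h2⟩ := Side.mem_toSet_iff.1 hx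
  refine ⟨fun i => ?_, h1⟩
  by_cases h : i = s.axis
  · rw [h, h1]
    exact s.level_mem
  · exact Ioo_subset_Icc_self (h2 i h)

/-- Used with `m` the centre of the square or the midpoint of a side: moving slightly towards `m`
makes all free coordinates interior. -/
theorem mem_closure_of_segment {x m : Plane} {A : Set Plane}
    (h : ∀ t ∈ Ioo (0 : ℝ) 1, x + t • (m - x) ∈ A) : x ∈ closure A := by
  have h0 : (0 : ℝ) ∈ closure (Ioo (0 : ℝ) 1) := by
    rw [closure_Ioo zero_ne_one]
    simp
  have := map_mem_closure (f := fun t : ℝ => x + t • (m - x)) (by fun_prop) h0 h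
  simpa using this

theorem segment_mem_Ioo {a m t : ℝ} (ha : a ∈ Icc (0 : ℝ) 1) (hm : m ∈ Ioo (0 : ℝ) 1)
    (ht : t ∈ Ioo (0 : ℝ) 1) : a + t * (m - a) ∈ Ioo (0 : ℝ) 1 := by
  obtain ⟨a0, a1⟩ := ha
  obtain ⟨m0, m1⟩ := hm
  obtain ⟨t0, t1⟩ := ht
  constructor
  · nlinarith [mul_pos t0 m0, mul_nonneg a0 (sub_nonneg.2 t1.le)]
  · nlinarith [mul_pos t0 (sub_pos.2 m1), mul_nonneg (sub_nonneg.2 a1) (sub_nonneg.2 t1.le)]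

theorem Side.closure_toSet (s : Side) : closure s.toSet = s.closed := by
  refine subset_antisymm (closure_minimal s.toSet_subset_closed s.isClosed_closed) ?_
  rintro x ⟨hx, hs⟩
  refine mem_closure_of_segment
    (m := WithLp.toLp 2 fun i => if i = s.axis then s.level else 1 / 2) fun t ht => ?_
  refine Side.mem_toSet_iff.2 ⟨by simp [hs], fun i hi => ?_⟩
  simpa [hi] using segment_mem_Ioo (m := 1 / 2) (hx i) (by norm_num) ht

theorem closure_square : closure square = closedSquare := by
  refine subset_antisymm (closure_minimal square_subset_closedSquare isClosed_closedSquare) ?_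
  intro x hx
  refine mem_closure_of_segment (m := WithLp.toLp 2 fun _ => 1 / 2) fun t ht => ?_
  refine mem_square_iff.2 fun i => ?_
  simpa using segment_mem_Ioo (m := 1 / 2) (hx i) (by norm_num) ht

theorem mem_frontier_square_iff {x : Plane} : x ∈ frontier square ↔ ∃ s : Side, x ∈ s.closed := by
  rw [isOpen_square.frontier_eq, closure_square]
  constructor
  · rintro ⟨hx, hn⟩
    have h01 : ∃ i, x i = 0 ∨ x i = 1 := by
      by_contra! h
      exact hn (mem_square_iff.2 fun i =>
        ⟨lt_of_le_of_ne (hx i).1 (h i).1.symm, lt_of_le_of_ne (hx i).2 (h i).2⟩)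
    obtain ⟨i, h⟩ := h01
    fin_cases i <;> rcases h with h | h
    exacts [⟨.l, hx, h⟩, ⟨.r, hx, h⟩, ⟨.b, hx, h⟩, ⟨.t, hx, h⟩]
  · rintro ⟨s, hx, hs⟩
    refine ⟨hx, fun h => ?_⟩
    have := mem_square_iff.1 h s.axis
    rw [hs] at this
    cases s <;> simp [Side.level] at this

theorem Side.eq_of_mem {s s' : Side} {x : Plane} (h : x ∈ s.toSet) (h' : x ∈ s'.closed) :
    s = s' := by
  obtain ⟨h1, h2⟩ := Side.mem_toSet_iff.1 h
  have h3 := h'.2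
  by_cases ha : s'.axis = s.axis
  · rw [ha, h1] at h3
    cases s <;> cases s' <;> simp_all [Side.axis, Side.level]
  · have := h2 _ ha
    rw [h3] at this
    cases s' <;> simp [Side.level] at this

/-- A subset of the boundary which contains the open sides in `S` and is contained in the union of
the closed sides in `S`. -/
structure IsPart (Γ₀ : Set Plane) (S : Set Side) : Prop where
  toSet_subset : ∀ s ∈ S, s.toSet ⊆ Γ₀
  exists_closed : ∀ x ∈ Γ₀, ∃ s ∈ S, x ∈ s.closed

theorem closure_iUnion_toSet (S : Set Side) :
    closure (⋃ s ∈ S, s.toSet) = ⋃ s ∈ S, s.closed := by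
  have : Finite Side := Finite.of_injective (fun s : Side => (s.axis, decide (s.level = 0)))
    (by intro s s' h; cases s <;> cases s' <;> simp_all [Side.axis, Side.level])
  rw [(Set.toFinite S).closure_biUnion]
  simp only [Side.closure_toSet]

/-- Everything below uses only the sandwich `IsPart`. It leaves open which corners belong to the
boundary part, so it also covers complements and the full boundary. -/
theorem isPart_boundaryPart (S : Set Side) : IsPart (boundaryPart S) S := by
  constructor
  · intro s hs x hx
    have hxf : x ∈ frontier square := mem_frontier_square_iff.2 ⟨s, s.toSet_subset_closed hx⟩
    -- The neighbourhood is the complement of the three other closed sides; there the boundary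
    -- consists of points of `s` only.
    refine ⟨hxf, {y | ∃ s', y ∈ s'.closed ∧ s' ≠ s}ᶜ, ?_, ?_, ?_⟩
    · have : {y | ∃ s' : Side, y ∈ s'.closed ∧ s' ≠ s} = ⋃ s' ∈ ({s' | s' ≠ s} : Set Side),
          s'.closed := by
        ext y
        simp [and_comm]
      rw [this, ← closure_iUnion_toSet]
      exact isClosed_closure.isOpen_compl
    · rintro ⟨s', h, hne⟩
      exact hne (Side.eq_of_mem hx h).symm
    · rintro y ⟨hy, hyf⟩
      obtain ⟨s', hs'⟩ := mem_frontier_square_iff.1 hyf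
      have : s' = s := by
        by_contra h
        exact hy ⟨s', hs', h⟩
      subst this
      rw [closure_iUnion_toSet]
      exact mem_biUnion hs hs'
  · rintro x ⟨hxf, U, -, hxU, hU⟩
    have := hU ⟨hxU, hxf⟩
    rw [closure_iUnion_toSet] at this
    simpa using this

theorem IsPart.closure_eq {Γ₀ : Set Plane} {S : Set Side} (h : IsPart Γ₀ S) :
    closure Γ₀ = ⋃ s ∈ S, s.closed := by
  rw [← closure_iUnion_toSet]
  refine subset_antisymm (closure_minimal (fun x hx => ?_) isClosed_closure)
    (closure_mono (iUnion₂_subset h.toSet_subset))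
  rw [closure_iUnion_toSet]
  simpa using h.exists_closed x hx

theorem IsPart.compl {Γ₀ : Set Plane} {S : Set Side} (h : IsPart Γ₀ S) :
    IsPart (complPart Γ₀) Sᶜ := by
  constructor
  · intro s hs x hx
    refine ⟨mem_frontier_square_iff.2 ⟨s, s.toSet_subset_closed hx⟩, ?_⟩
    rw [h.closure_eq]
    simp only [mem_iUnion, not_exists]
    intro s' hs' hx'
    rw [← Side.eq_of_mem hx hx'] at hs'
    exact hs hs'
  · rintro x ⟨hxf, hn⟩
    rw [h.closure_eq] at hn
    obtain ⟨s, hs⟩ := mem_frontier_square_iff.1 hxf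
    exact ⟨s, fun hS => hn (mem_biUnion hS hs), hs⟩

theorem isPart_frontier : IsPart (frontier square) univ :=
  ⟨fun s _ _ hx => mem_frontier_square_iff.2 ⟨s, s.toSet_subset_closed hx⟩,
    fun _ hx => (mem_frontier_square_iff.1 hx).imp fun _ hs => ⟨trivial, hs⟩⟩

theorem IsPart.subset_frontier {Γ₀ : Set Plane} {S : Set Side} (h : IsPart Γ₀ S) :
    Γ₀ ⊆ frontier square := fun x hx =>
  mem_frontier_square_iff.2 ((h.exists_closed x hx).imp fun _ hs => hs.2)

/-- Test functions vanish on the closed sides in the boundary part. -/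
theorem IsPart.eq_zero {V : Type*} [NormedAddCommGroup V] [NormedSpace ℝ V] {Γ₀ : Set Plane}
    {S : Set Side} (h : IsPart Γ₀ S) {φ : Plane → V} (hφ : IsTest Γ₀ φ) {s : Side} (hs : s ∈ S)
    {x : Plane} (hx : x ∈ s.closed) : φ x = 0 := by
  have hcl : IsClosed {x | φ x = 0} := isClosed_eq hφ.smooth.continuous continuous_const
  rw [← s.closure_toSet] at hx
  refine closure_minimal (fun y hy => ?_) hcl hx
  obtain ⟨δ, hδ, hd⟩ := hφ.away
  refine image_eq_zero_of_notMem_tsupport fun hy' => ?_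
  have := hd y hy' y (h.toSet_subset s hs hy)
  rw [dist_self] at this
  exact absurd this (not_le.2 hδ)

/-! ### Continuous functions as elements of `L²` -/

theorem isCompact_closedSquare : IsCompact closedSquare := by
  have : closedSquare = (EuclideanSpace.equiv (Fin 2) ℝ).toHomeomorph ⁻¹'
      (univ.pi fun _ => Icc (0 : ℝ) 1) := by
    ext x
    simp only [closedSquare, mem_preimage, Set.mem_pi, mem_univ, true_imp_iff]
    rfl
  rw [this, Homeomorph.isCompact_preimage]
  exact isCompact_univ_pi fun _ => isCompact_Icc

instance isFiniteMeasure_vol : IsFiniteMeasure vol :=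
  ⟨by
    rw [Measure.restrict_apply_univ]
    exact (measure_mono square_subset_closedSquare).trans_lt
      isCompact_closedSquare.measure_lt_top⟩

section Continuous

variable {V : Type*} [NormedAddCommGroup V]

theorem ae_vol_mem : ∀ᵐ x ∂vol, x ∈ square := ae_restrict_mem isOpen_square.measurableSet

theorem exists_bound_square {u : Plane → V} (hu : Continuous u) :
    ∃ C, ∀ x ∈ square, ‖u x‖ ≤ C := by
  obtain ⟨C, hC⟩ := isCompact_closedSquare.exists_bound_of_continuousOn hu.continuousOn
  exact ⟨C, fun x hx => hC x (square_subset_closedSquare hx)⟩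

theorem memLp_vol [SecondCountableTopology V] {u : Plane → V} (hu : Continuous u) (p : ℝ≥0∞) :
    MemLp u p vol := by
  obtain ⟨C, hC⟩ := exists_bound_square hu
  exact MemLp.of_bound hu.aestronglyMeasurable C (ae_vol_mem.mono hC)

theorem integrable_vol [SecondCountableTopology V] {u : Plane → V} (hu : Continuous u) :
    Integrable u vol :=
  memLp_one_iff_integrable.1 (memLp_vol hu 1)

/-- The class in `L²` of a continuous function. -/
def toL2 [SecondCountableTopology V] (u : Plane → V) (hu : Continuous u) : Lp V 2 vol :=
  (memLp_vol hu 2).toLp u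

theorem coeFn_toL2 [SecondCountableTopology V] {u : Plane → V} (hu : Continuous u) :
    toL2 u hu =ᵐ[vol] u := MemLp.coeFn_toLp _

theorem inner_toL2 [InnerProductSpace ℝ V] [SecondCountableTopology V] {u v : Plane → V}
    (hu : Continuous u) (hv : Continuous v) :
    inner ℝ (toL2 u hu) (toL2 v hv) = ∫ x, inner ℝ (u x) (v x) ∂vol := by
  rw [L2.inner_def]
  refine integral_congr_ae ?_
  filter_upwards [coeFn_toL2 hu, coeFn_toL2 hv] with x h1 h2
  rw [h1, h2]

/-- Bounded pointwise convergence on the square. -/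
structure BddTendsto (u : ℕ → Plane → V) (v : Plane → V) : Prop where
  bound : ∃ C, ∀ n, ∀ x ∈ square, ‖u n x‖ ≤ C
  tendsto : ∀ x ∈ square, Tendsto (fun n => u n x) atTop (𝓝 (v x))

theorem BddTendsto.tendsto_toL2 [InnerProductSpace ℝ V] [SecondCountableTopology V]
    {u : ℕ → Plane → V} {v : Plane → V} (h : BddTendsto u v) (hu : ∀ n, Continuous (u n))
    (hv : Continuous v) :
    Tendsto (fun n => toL2 (u n) (hu n)) atTop (𝓝 (toL2 v hv)) := by
  obtain ⟨C, hC⟩ := h.bound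
  have hCv : ∀ x ∈ square, ‖v x‖ ≤ C := fun x hx =>
    le_of_tendsto' (h.tendsto x hx).norm fun n => hC n x hx
  have h2 : Tendsto (fun n => ∫ x, ‖u n x - v x‖ ^ 2 ∂vol) atTop (𝓝 (∫ _, (0 : ℝ) ∂vol)) := by
    refine tendsto_integral_of_dominated_convergence (fun _ => (C + C) ^ 2)
      (fun n => (((hu n).sub hv).norm.pow 2).aestronglyMeasurable) (integrable_const _)
      (fun n => ?_) ?_
    · filter_upwards [ae_vol_mem] with x hx
      rw [norm_pow, norm_norm]
      gcongr
      exact (norm_sub_le _ _).trans (add_le_add (hC n x hx) (hCv x hx))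
    · filter_upwards [ae_vol_mem] with x hx
      have := ((h.tendsto x hx).sub_const (v x)).norm.pow 2
      simpa using this
  have h3 : ∀ n, ‖toL2 (u n) (hu n) - toL2 v hv‖ ^ 2 = ∫ x, ‖u n x - v x‖ ^ 2 ∂vol := by
    intro n
    have : toL2 (u n) (hu n) - toL2 v hv = toL2 (fun x => u n x - v x) ((hu n).sub hv) :=
      (MemLp.toLp_sub (memLp_vol (hu n) 2) (memLp_vol hv 2)).symm
    rw [this, ← real_inner_self_eq_norm_sq, inner_toL2]
    simp only [real_inner_self_eq_norm_sq]
  rw [tendsto_iff_norm_sub_tendsto_zero]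
  simp only [← h3, integral_zero] at h2
  have := h2.sqrt
  simpa [Real.sqrt_sq] using this

end Continuous

/-! ### Integration by parts on the square -/

theorem integral_vol_eq (g : Plane → ℝ) :
    ∫ x, g x ∂vol = ∫ y in Icc (0 : Fin 2 → ℝ) 1, g (WithLp.toLp 2 y) := by
  have hmp := EuclideanSpace.volume_preserving_symm_measurableEquiv_toLp (Fin 2)
  have h := (hmp.symm).setIntegral_preimage_emb (MeasurableEquiv.measurableEmbedding _) g square
  have hs : (MeasurableEquiv.toLp 2 (Fin 2 → ℝ)) ⁻¹' square = univ.pi fun _ => Ioo (0 : ℝ) 1 := by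
    ext y
    simp [mem_square_iff, Set.mem_pi]
  have hae : (univ.pi fun _ => Ioo (0 : ℝ) 1 : Set (Fin 2 → ℝ)) =ᵐ[volume]
      Icc (0 : Fin 2 → ℝ) 1 := Measure.univ_pi_Ioo_ae_eq_Icc
  rw [← setIntegral_congr_set hae, ← hs]
  exact h.symm

/-- Only the product has to vanish on the two faces orthogonal to direction `i`. This suits mixed
conditions, where one factor vanishes on some sides and the other factor on the rest. -/
theorem integral_parts_square {u v : Plane → ℝ} (hu : ContDiff ℝ 1 u) (hv : ContDiff ℝ 1 v)
    (i : Fin 2) (hb : ∀ x ∈ closedSquare, x i = 0 ∨ x i = 1 → u x * v x = 0) :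
    ∫ x, fderiv ℝ u x (EuclideanSpace.single i 1) * v x ∂vol =
      - ∫ x, u x * fderiv ℝ v x (EuclideanSpace.single i 1) ∂vol := by
  set e : Plane := EuclideanSpace.single i 1 with he
  have cu : Continuous fun x => fderiv ℝ u x e :=
    (hu.continuous_fderiv (by simp)).clm_apply continuous_const
  have cv : Continuous fun x => fderiv ℝ v x e :=
    (hv.continuous_fderiv (by simp)).clm_apply continuous_const
  have c1 : Continuous fun x => fderiv ℝ u x e * v x := cu.mul hv.continuous
  have c2 : Continuous fun x => u x * fderiv ℝ v x e := hu.continuous.mul cv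
  rw [eq_neg_iff_add_eq_zero, ← integral_add (integrable_vol c1) (integrable_vol c2),
    integral_vol_eq]
  let eL : (Fin 2 → ℝ) ≃L[ℝ] Plane := (EuclideanSpace.equiv (Fin 2) ℝ).symm
  have heL : ∀ y : Fin 2 → ℝ, eL y = WithLp.toLp 2 y := fun y => rfl
  have hd : ∀ y : Fin 2 → ℝ, HasFDerivAt (fun y => u (eL y) * v (eL y))
      ((u (eL y) • fderiv ℝ v (eL y) + v (eL y) • fderiv ℝ u (eL y)).comp
        (eL : (Fin 2 → ℝ) →L[ℝ] Plane)) y := fun y =>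
    ((hu.differentiable (by simp) (eL y)).hasFDerivAt.mul
      (hv.differentiable (by simp) (eL y)).hasFDerivAt).comp y eL.hasFDerivAt
  -- Divergence theorem for the field with `u v` in slot `i` and zero elsewhere; `hb` removes the
  -- two remaining face integrals.
  have key := integral_divergence_of_hasFDerivAt_off_countable' (0 : Fin 2 → ℝ) 1
    (by intro j; simp)
    (fun j y => if j = i then u (eL y) * v (eL y) else 0)
    (fun j y => if j = i then (u (eL y) • fderiv ℝ v (eL y) + v (eL y) • fderiv ℝ u (eL y)).comp
        (eL : (Fin 2 → ℝ) →L[ℝ] Plane) else 0) ∅ countable_empty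
    (fun j => by
      by_cases h : j = i
      · simp only [h, if_true]
        exact ((hu.continuous.comp eL.continuous).mul
          (hv.continuous.comp eL.continuous)).continuousOn
      · simp only [h, if_false]
        exact continuousOn_const)
    (fun y _ j => by
      by_cases h : j = i
      · simp only [h, if_true]
        exact hd y
      · simp only [h, if_false]
        exact hasFDerivAt_const _ _)
  have hsum : ∀ y : Fin 2 → ℝ, (∑ j, (if j = i then
      (u (eL y) • fderiv ℝ v (eL y) + v (eL y) • fderiv ℝ u (eL y)).comp
        (eL : (Fin 2 → ℝ) →L[ℝ] Plane) else 0) (Pi.single j 1)) =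
      fderiv ℝ u (eL y) e * v (eL y) + u (eL y) * fderiv ℝ v (eL y) e := by
    intro y
    rw [Finset.sum_eq_single i (fun j _ hj => by simp [hj]) (by simp)]
    have : eL (Pi.single i 1) = e := rfl
    simp only [if_true, ContinuousLinearMap.comp_apply, _root_.add_apply,
      _root_.smul_apply, smul_eq_mul, ContinuousLinearEquiv.coe_coe, this]
    ring
  simp only [hsum] at key
  refine (key ?_).trans ?_
  · exact ((c1.add c2).comp eL.continuous).continuousOn.integrableOn_compact isCompact_Icc
  · refine Finset.sum_eq_zero fun j _ => ?_
    by_cases h : j = i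
    · subst h
      have hz : ∀ c : ℝ, c = 0 ∨ c = 1 → ∀ x ∈ Icc ((0 : Fin 2 → ℝ) ∘ j.succAbove)
          ((1 : Fin 2 → ℝ) ∘ j.succAbove),
          u (eL (j.insertNth c x)) * v (eL (j.insertNth c x)) = 0 := by
        intro c hc x hx
        refine hb _ (fun k => ?_) ?_
        · rw [heL]
          rcases Fin.eq_self_or_eq_succAbove j k with hk | ⟨l, hk⟩
          · subst hk
            rcases hc with rfl | rfl <;> simp
          · subst hk
            simpa using ⟨hx.1 l, hx.2 l⟩
        · simpa [heL] using hc
      simp only [if_true]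
      rw [setIntegral_eq_zero_of_forall_eq_zero (hz _ (by simp)),
        setIntegral_eq_zero_of_forall_eq_zero (hz _ (by simp)), sub_zero]
    · simp [h]

/-! ### Membership in the operators and their adjoints -/

theorem gradOp_graph (Γ₀ : Set Plane) :
    (gradOp Γ₀).graph = (gradGraph Γ₀).topologicalClosure :=
  Submodule.toLinearPMap_graph_eq _ (gradGraph_isGraph Γ₀)

theorem rotOp_graph (Γ₀ : Set Plane) :
    (rotOp Γ₀).graph = (rotGraph Γ₀).topologicalClosure :=
  Submodule.toLinearPMap_graph_eq _ (rotGraph_isGraph Γ₀)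

theorem continuous_gradient {u : Plane → ℝ} (hu : ContDiff ℝ ∞ u) : Continuous (gradient u) :=
  (InnerProductSpace.toDual ℝ Plane).symm.continuous.comp (hu.continuous_fderiv (by simp))

theorem continuous_rot {U : Plane → Plane} (hU : ContDiff ℝ ∞ U) : Continuous (rot U) := by
  have h := hU.continuous_fderiv (by simp)
  exact ((EuclideanSpace.proj (𝕜 := ℝ) (1 : Fin 2)).continuous.comp
    (h.clm_apply continuous_const)).sub
    ((EuclideanSpace.proj (𝕜 := ℝ) (0 : Fin 2)).continuous.comp (h.clm_apply continuous_const))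

theorem mem_gradOp_graph {Γ₀ : Set Plane} {φ : ℕ → Plane → ℝ} (hφ : ∀ n, IsTest Γ₀ (φ n))
    {u : Plane → ℝ} {U : Plane → Plane} (hu : Continuous u) (hU : Continuous U)
    (h1 : BddTendsto φ u) (h2 : BddTendsto (fun n => gradient (φ n)) U) :
    (toL2 u hu, toL2 U hU) ∈ (gradOp Γ₀).graph := by
  rw [gradOp_graph]
  refine mem_closure_of_tendsto ((h1.tendsto_toL2 (fun n => (hφ n).smooth.continuous)
    hu).prodMk_nhds (h2.tendsto_toL2 (fun n => continuous_gradient (hφ n).smooth) hU))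
    (Eventually.of_forall fun n => ?_)
  exact ⟨φ n, hφ n, coeFn_toL2 (hφ n).smooth.continuous,
    coeFn_toL2 (continuous_gradient (hφ n).smooth)⟩

theorem mem_rotOp_graph {Γ₀ : Set Plane} {Φ : ℕ → Plane → Plane} (hΦ : ∀ n, IsTest Γ₀ (Φ n))
    {u : Plane → ℝ} {U : Plane → Plane} (hu : Continuous u) (hU : Continuous U)
    (h1 : BddTendsto Φ U) (h2 : BddTendsto (fun n => rot (Φ n)) u) :
    (toL2 U hU, toL2 u hu) ∈ (rotOp Γ₀).graph := by
  rw [rotOp_graph]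
  refine mem_closure_of_tendsto ((h1.tendsto_toL2 (fun n => (hΦ n).smooth.continuous)
    hU).prodMk_nhds (h2.tendsto_toL2 (fun n => continuous_rot (hΦ n).smooth) hu))
    (Eventually.of_forall fun n => ?_)
  exact ⟨Φ n, hΦ n, coeFn_toL2 (hΦ n).smooth.continuous, coeFn_toL2 (continuous_rot (hΦ n).smooth)⟩

/-- A compact subset of the open square has positive distance from the boundary. These functions
make the domains dense, as needed for the adjoints. -/
theorem isTest_of_tsupport_subset {V : Type*} [NormedAddCommGroup V] [NormedSpace ℝ V]
    {Γ₀ : Set Plane} (hΓ : Γ₀ ⊆ frontier square) {φ : Plane → V} (hφ : ContDiff ℝ ∞ φ)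
    (hc : HasCompactSupport φ) (hs : tsupport φ ⊆ square) : IsTest Γ₀ φ := by
  obtain ⟨δ, hδ, hsub⟩ := IsCompact.exists_thickening_subset_open hc isOpen_square hs
  refine ⟨hφ, hc, δ, hδ, fun x hx y hy => ?_⟩
  by_contra! h
  have hy' : y ∈ square := hsub (Metric.mem_thickening_iff.2 ⟨x, hx, by rwa [dist_comm]⟩)
  have := hΓ hy
  rw [isOpen_square.frontier_eq] at this
  exact this.2 hy'

theorem dense_domain_of_orthogonal {E F : Type*} [NormedAddCommGroup E] [InnerProductSpace ℝ E]
    [CompleteSpace E] [NormedAddCommGroup F] [InnerProductSpace ℝ F] {A : E →ₗ.[ℝ] F}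
    (h : ∀ y : E, (∀ x ∈ A.domain, inner ℝ x y = 0) → y = 0) : Dense (A.domain : Set E) := by
  rw [Submodule.dense_iff_topologicalClosure_eq_top, Submodule.topologicalClosure_eq_top_iff,
    Submodule.eq_bot_iff]
  exact fun y hy => h y ((Submodule.mem_orthogonal _ _).1 hy)

theorem mem_domain_gradOp {Γ₀ : Set Plane} {φ : Plane → ℝ} (hφ : IsTest Γ₀ φ) :
    toL2 φ hφ.smooth.continuous ∈ (gradOp Γ₀).domain := by
  refine LinearPMap.mem_domain_of_mem_graph (y := toL2 _ (continuous_gradient hφ.smooth)) ?_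
  rw [gradOp_graph]
  exact Submodule.le_topologicalClosure _
    ⟨φ, hφ, coeFn_toL2 hφ.smooth.continuous, coeFn_toL2 (continuous_gradient hφ.smooth)⟩

theorem mem_domain_rotOp {Γ₀ : Set Plane} {Φ : Plane → Plane} (hΦ : IsTest Γ₀ Φ) :
    toL2 Φ hΦ.smooth.continuous ∈ (rotOp Γ₀).domain := by
  refine LinearPMap.mem_domain_of_mem_graph (y := toL2 _ (continuous_rot hΦ.smooth)) ?_
  rw [rotOp_graph]
  exact Submodule.le_topologicalClosure _
    ⟨Φ, hΦ, coeFn_toL2 hΦ.smooth.continuous, coeFn_toL2 (continuous_rot hΦ.smooth)⟩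

theorem dense_domain_gradOp {Γ₀ : Set Plane} (hΓ : Γ₀ ⊆ frontier square) :
    Dense ((gradOp Γ₀).domain : Set L2) := by
  refine dense_domain_of_orthogonal fun y hy => ?_
  refine Lp.eq_zero_iff_ae_eq_zero.2 (ae_zero_of_pairing (Lp.memLp y) fun ψ hψ hc hs => ?_)
  have := hy _ (mem_domain_gradOp (isTest_of_tsupport_subset hΓ hψ hc hs))
  rw [L2.inner_def] at this
  rw [← this]
  refine integral_congr_ae ?_
  filter_upwards [coeFn_toL2 hψ.continuous] with x hx
  rw [hx]
  simp [mul_comm]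

theorem dense_domain_rotOp {Γ₀ : Set Plane} (hΓ : Γ₀ ⊆ frontier square) :
    Dense ((rotOp Γ₀).domain : Set L2Vec) := by
  refine dense_domain_of_orthogonal fun y hy => ?_
  have hz : ∀ i : Fin 2, (fun x => y x i) =ᵐ[vol] 0 := by
    intro i
    refine ae_zero_of_pairing ((EuclideanSpace.proj (𝕜 := ℝ) i).comp_memLp' (Lp.memLp y))
      fun ψ hψ hc hs => ?_
    have hT : IsTest Γ₀ fun x => ψ x • (EuclideanSpace.single i 1 : Plane) :=
      isTest_of_tsupport_subset hΓ (hψ.smul contDiff_const) hc.smul_right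
        ((tsupport_smul_subset_left _ _).trans hs)
    have := hy _ (mem_domain_rotOp hT)
    rw [L2.inner_def] at this
    rw [← this]
    refine integral_congr_ae ?_
    filter_upwards [coeFn_toL2 hT.smooth.continuous] with x hx
    rw [hx]
    simp [real_inner_smul_left, EuclideanSpace.inner_single_left]
  refine (Lp.eq_zero_iff_ae_eq_zero).2 ?_
  filter_upwards [hz 0, hz 1] with x h1 h2
  ext i
  fin_cases i
  · exact h1
  · exact h2

/-- The adjoint relation is a closed condition on the graph, so it suffices to check it on the
classical gradient, where everything is smooth. -/
theorem mem_gradOp_adjoint {Γ₀ : Set Plane} (hΓ : Γ₀ ⊆ frontier square) {u : Plane → ℝ}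
    {U : Plane → Plane} (hu : Continuous u) (hU : Continuous U)
    (h : ∀ φ, IsTest Γ₀ φ →
      ∫ x, inner ℝ (gradient φ x) (U x) ∂vol = ∫ x, φ x * u x ∂vol) :
    (toL2 U hU, toL2 u hu) ∈ (gradOp Γ₀).adjoint.graph := by
  rw [mem_adjoint_graph_iff (dense_domain_gradOp hΓ), gradOp_graph]
  have hcl : IsClosed {p : L2 × L2Vec | inner ℝ p.2 (toL2 U hU) = inner ℝ p.1 (toL2 u hu)} :=
    isClosed_eq (by fun_prop) (by fun_prop)
  refine fun p hp => closure_minimal (s := (gradGraph Γ₀ : Set (L2 × L2Vec))) ?_ hcl hp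
  rintro q ⟨φ, hφ, h1, h2⟩
  simp only [Set.mem_ofPred_eq, L2.inner_def]
  refine (integral_congr_ae ?_).trans ((h φ hφ).trans (integral_congr_ae ?_))
  · filter_upwards [h2, coeFn_toL2 hU] with x e1 e2
    rw [e1, e2]
  · filter_upwards [h1, coeFn_toL2 hu] with x e1 e2
    rw [e1, e2]
    simp [mul_comm]

theorem mem_rotOp_adjoint {Γ₀ : Set Plane} (hΓ : Γ₀ ⊆ frontier square) {u : Plane → ℝ}
    {U : Plane → Plane} (hu : Continuous u) (hU : Continuous U)
    (h : ∀ Φ, IsTest Γ₀ Φ →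
      ∫ x, rot Φ x * u x ∂vol = ∫ x, inner ℝ (Φ x) (U x) ∂vol) :
    (toL2 u hu, toL2 U hU) ∈ (rotOp Γ₀).adjoint.graph := by
  rw [mem_adjoint_graph_iff (dense_domain_rotOp hΓ), rotOp_graph]
  have hcl : IsClosed {p : L2Vec × L2 | inner ℝ p.2 (toL2 u hu) = inner ℝ p.1 (toL2 U hU)} :=
    isClosed_eq (by fun_prop) (by fun_prop)
  refine fun p hp => closure_minimal (s := (rotGraph Γ₀ : Set (L2Vec × L2))) ?_ hcl hp
  rintro q ⟨Φ, hΦ, h1, h2⟩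
  simp only [Set.mem_ofPred_eq, L2.inner_def]
  refine Eq.trans (integral_congr_ae ?_) ((h Φ hΦ).trans (integral_congr_ae ?_))
  · filter_upwards [h2, coeFn_toL2 hu] with x e1 e2
    rw [e1, e2]
    simp [mul_comm]
  · filter_upwards [h1, coeFn_toL2 hU] with x e1 e2
    rw [e1, e2]

/-! ### Smooth maps of the line clamping it to the unit interval -/

/-- A smooth function which vanishes for `t ≤ 1` and is the identity for `t ≥ 2`. -/
def softPart (t : ℝ) : ℝ := t * Real.smoothTransition (t - 1)

theorem contDiff_softPart : ContDiff ℝ ∞ softPart :=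
  contDiff_id.mul (Real.smoothTransition.contDiff.comp (contDiff_id.sub contDiff_const))

theorem softPart_of_le {t : ℝ} (ht : t ≤ 1) : softPart t = 0 := by
  rw [softPart, Real.smoothTransition.zero_of_nonpos (by linarith), mul_zero]

theorem softPart_of_ge {t : ℝ} (ht : 2 ≤ t) : softPart t = t := by
  rw [softPart, Real.smoothTransition.one_of_one_le (by linarith), mul_one]

theorem softPart_nonneg (t : ℝ) : 0 ≤ softPart t := by
  rcases le_total t 1 with h | h
  · rw [softPart_of_le h]
  · exact mul_nonneg (by linarith) (Real.smoothTransition.nonneg _)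

theorem softPart_le {t s : ℝ} (h : t ≤ s) (hs : 0 ≤ s) : softPart t ≤ s := by
  rcases le_total t 1 with h1 | h1
  · rwa [softPart_of_le h1]
  · exact (mul_le_of_le_one_right (by linarith) (Real.smoothTransition.le_one _)).trans h

theorem exists_deriv_softPart_le : ∃ C, 0 ≤ C ∧ ∀ t, |deriv softPart t| ≤ C := by
  -- Left of 0 the derivative is 0 and right of 3 it is 1, so only a compact interval needs an
  -- argument; the 1 in the maximum accounts for the right part.
  obtain ⟨C, hC⟩ := (isCompact_Icc (a := (0 : ℝ)) (b := 3)).exists_bound_of_continuousOn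
    (contDiff_softPart.continuous_deriv (by simp)).continuousOn
  refine ⟨max C 1, by positivity, fun t => ?_⟩
  rcases lt_or_ge t 0 with h | h
  · have : softPart =ᶠ[𝓝 t] fun _ => 0 := by
      filter_upwards [Iio_mem_nhds h] with s hs
      exact softPart_of_le (le_of_lt (lt_trans hs one_pos))
    rw [this.deriv_eq]
    simp
  rcases le_or_gt t 3 with h3 | h3
  · exact (hC t ⟨h, h3⟩).trans (le_max_left _ _)
  · have : softPart =ᶠ[𝓝 t] id := by
      filter_upwards [Ioi_mem_nhds h3] with s hs
      exact softPart_of_ge (by linarith [mem_Ioi.1 hs])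
    rw [this.deriv_eq]
    simp

/-- A smooth map of the line to `[0, 1]` which is constant near `0` and `1`. -/
def clamp (n : ℕ) (x : ℝ) : ℝ :=
  -- Rescaled `softPart` flattens the line near 0; reflecting by t ↦ 1 - t and repeating flattens it
  -- near 1. The offset 4 keeps the transition zones, of width 2/(n + 4), from overlapping.
  1 - softPart ((n + 4) * (1 - softPart ((n + 4) * x) / (n + 4))) / (n + 4)

theorem contDiff_clamp (n : ℕ) : ContDiff ℝ ∞ (clamp n) := by
  have h := contDiff_softPart
  exact contDiff_const.sub ((h.comp (contDiff_const.mul (contDiff_const.sub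
    ((h.comp (contDiff_const.mul contDiff_id)).div_const _)))).div_const _)

theorem clamp_mem (n : ℕ) (x : ℝ) : clamp n x ∈ Icc (0 : ℝ) 1 := by
  have hn : (0 : ℝ) < n + 4 := by positivity
  constructor
  · have : softPart ((n + 4) * (1 - softPart ((n + 4) * x) / (n + 4))) ≤ n + 4 := by
      refine softPart_le ?_ hn.le
      refine mul_le_of_le_one_right hn.le ?_
      have := div_nonneg (softPart_nonneg ((n + 4) * x)) hn.le
      linarith
    have := (div_le_one hn).2 this
    rw [clamp]
    linarith
  · have := div_nonneg (softPart_nonneg ((n + 4) * (1 - softPart ((n + 4) * x) / (n + 4)))) hn.le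
    rw [clamp]
    linarith

theorem clamp_of_lt {n : ℕ} {x : ℝ} (hx : x < 1 / (n + 4)) : clamp n x = 0 := by
  have hn : (0 : ℝ) < n + 4 := by positivity
  have h1 : (n + 4) * x ≤ 1 := by
    rw [lt_div_iff₀ hn] at hx
    linarith
  rw [clamp, softPart_of_le h1, zero_div, sub_zero, mul_one,
    softPart_of_ge (by linarith [n.cast_nonneg (α := ℝ)]), div_self hn.ne', sub_self]

theorem clamp_of_gt {n : ℕ} {x : ℝ} (hx : 1 - 1 / (n + 4) < x) : clamp n x = 1 := by
  have hn : (0 : ℝ) < n + 4 := by positivity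
  have hn0 := n.cast_nonneg (α := ℝ)
  have h1 : (n + 4) * (1 - x) ≤ 1 := by
    have : 1 - x < 1 / (n + 4) := by linarith
    rw [lt_div_iff₀ hn] at this
    linarith
  rw [clamp, softPart_of_ge (t := (n + 4) * x) (by linarith), mul_div_cancel_left₀ _ hn.ne',
    softPart_of_le h1]
  simp

theorem clamp_eq_self {n : ℕ} {x : ℝ} (h0 : 2 / (n + 4) < x) (h1 : x < 1 - 2 / (n + 4)) :
    clamp n x = x := by
  have hn : (0 : ℝ) < n + 4 := by positivity
  have h2 : 2 ≤ (n + 4) * x := by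
    rw [div_lt_iff₀ hn] at h0
    linarith
  have h3 : 2 ≤ (n + 4) * (1 - x) := by
    have : 2 / (n + 4) < 1 - x := by linarith
    rw [div_lt_iff₀ hn] at this
    linarith
  rw [clamp, softPart_of_ge h2, mul_div_cancel_left₀ _ hn.ne', softPart_of_ge h3,
    mul_div_cancel_left₀ _ hn.ne']
  ring

/-- Equality on a neighbourhood, and not just at the point, is what lets derivatives converge too.
-/
theorem eventually_clamp_eq {x : ℝ} (hx : x ∈ Ioo (0 : ℝ) 1) :
    ∀ᶠ n in atTop, ∀ᶠ y in 𝓝 x, clamp n y = y := by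
  have ht : Tendsto (fun n : ℕ => (2 : ℝ) / (n + 4)) atTop (𝓝 0) :=
    tendsto_const_nhds.div_atTop
      (tendsto_natCast_atTop_atTop.atTop_add tendsto_const_nhds)
  filter_upwards [ht.eventually_lt_const hx.1, ht.eventually_lt_const (sub_pos.2 hx.2)]
    with n h0 h1
  filter_upwards [Ioi_mem_nhds h0, Iio_mem_nhds (show x < 1 - 2 / ((n : ℝ) + 4) by linarith)]
    with y hy0 hy1
  exact clamp_eq_self hy0 hy1

/-- The factor n + 4 inside `softPart` cancels the division outside, so first derivatives are
bounded uniformly in `n`. This supplies the dominating bound for the approximations. -/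
theorem exists_deriv_clamp_le : ∃ C, 0 ≤ C ∧ ∀ n x, |deriv (clamp n) x| ≤ C := by
  obtain ⟨C, hC0, hC⟩ := exists_deriv_softPart_le
  refine ⟨C * C, by positivity, fun n x => ?_⟩
  have hn : (0 : ℝ) < n + 4 := by positivity
  have hd : ∀ t, HasDerivAt softPart (deriv softPart t) t := fun t =>
    (contDiff_softPart.differentiable (by simp) t).hasDerivAt
  have h1 : ∀ x, HasDerivAt (fun x => softPart ((n + 4) * x) / (n + 4))
      (deriv softPart ((n + 4) * x)) x := by
    intro x
    have := ((hd ((n + 4) * x)).comp x ((hasDerivAt_id x).const_mul ((n : ℝ) + 4))).div_const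
      ((n : ℝ) + 4)
    convert! this using 1
    field_simp
  have h2 : HasDerivAt (clamp n) (deriv softPart ((n + 4) * (1 - softPart ((n + 4) * x) / (n + 4)))
      * deriv softPart ((n + 4) * x)) x := by
    have := ((h1 (1 - softPart ((n + 4) * x) / (n + 4))).comp x
      ((h1 x).const_sub 1)).const_sub 1
    convert! this using 1
    ring
  rw [h2.deriv, abs_mul]
  gcongr
  · exact hC _
  · exact hC _

/-! ### Pulling back along the clamping maps of the plane -/

/-- Coordinatewise clamping of the plane to the closed square. -/
def clampMap (n : ℕ) (x : Plane) : Plane := WithLp.toLp 2 fun i => clamp n (x i)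

theorem clampMap_apply (n : ℕ) (x : Plane) (i : Fin 2) : clampMap n x i = clamp n (x i) := rfl

theorem contDiff_coord (i : Fin 2) : ContDiff ℝ ∞ fun x : Plane => x i :=
  (EuclideanSpace.proj (𝕜 := ℝ) i).contDiff

theorem contDiff_clampMap (n : ℕ) : ContDiff ℝ ∞ (clampMap n) :=
  contDiff_euclidean.2 fun i => (contDiff_clamp n).comp (contDiff_coord i)

theorem clampMap_mem (n : ℕ) (x : Plane) : clampMap n x ∈ closedSquare := fun i =>
  clamp_mem n (x i)

theorem fderiv_comp_coord {g : ℝ → ℝ} {x : Plane} {i : Fin 2} (hg : DifferentiableAt ℝ g (x i))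
    (v : Plane) : fderiv ℝ (fun y : Plane => g (y i)) x v = deriv g (x i) * v i := by
  have h : HasFDerivAt (fun y : Plane => y i) (EuclideanSpace.proj (𝕜 := ℝ) i) x :=
    (EuclideanSpace.proj (𝕜 := ℝ) i).hasFDerivAt
  have := hg.hasDerivAt.hasFDerivAt.comp x h
  have h2 := this.fderiv
  simp only [Function.comp_def] at h2
  rw [h2]
  simp [mul_comm]

theorem fderiv_apply_coord {Φ : Plane → Plane} {x : Plane} (hΦ : DifferentiableAt ℝ Φ x)
    (i : Fin 2) (v : Plane) : fderiv ℝ (fun y => Φ y i) x v = fderiv ℝ Φ x v i := by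
  have := ((EuclideanSpace.proj i : Plane →L[ℝ] ℝ).hasFDerivAt.comp x hΦ.hasFDerivAt).fderiv
  exact congrArg (fun L => L v) this

theorem fderiv_clampMap (n : ℕ) (x : Plane) (i : Fin 2) :
    fderiv ℝ (clampMap n) x (EuclideanSpace.single i 1) =
      deriv (clamp n) (x i) • EuclideanSpace.single i 1 := by
  ext j
  rw [← fderiv_apply_coord ((contDiff_clampMap n).differentiable (by simp) x)]
  simp only [clampMap_apply]
  rw [fderiv_comp_coord ((contDiff_clamp n).differentiable (by simp) _)]
  by_cases h : j = i
  · subst h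
    simp
  · simp [h]

theorem fderiv_comp_clampMap {u : Plane → ℝ} (hu : ContDiff ℝ ∞ u) (n : ℕ) (x : Plane)
    (i : Fin 2) :
    fderiv ℝ (fun y => u (clampMap n y)) x (EuclideanSpace.single i 1) =
      deriv (clamp n) (x i) * fderiv ℝ u (clampMap n x) (EuclideanSpace.single i 1) := by
  have := ((hu.differentiable (by simp) (clampMap n x)).hasFDerivAt.comp x
    ((contDiff_clampMap n).differentiable (by simp) x).hasFDerivAt).fderiv
  simp only [Function.comp_def] at this
  rw [this, ContinuousLinearMap.comp_apply, fderiv_clampMap]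
  simp

theorem eventually_clampMap_eq {x : Plane} (hx : x ∈ square) :
    ∀ᶠ n in atTop, ∀ᶠ y in 𝓝 x, clampMap n y = y := by
  have h := mem_square_iff.1 hx
  filter_upwards [eventually_clamp_eq (h 0), eventually_clamp_eq (h 1)] with n h0 h1
  have c : ∀ i : Fin 2, Tendsto (fun y : Plane => y i) (𝓝 x) (𝓝 (x i)) := fun i =>
    (contDiff_coord i).continuous.tendsto x
  filter_upwards [(c 0).eventually h0, (c 1).eventually h1] with y hy0 hy1
  ext i
  fin_cases i
  · exact hy0
  · exact hy1

/-- A smooth cutoff function on the plane which is `1` near the closed square. -/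
def cutoff : ContDiffBump (0 : Plane) := ⟨2, 3, by norm_num, by norm_num⟩

theorem eventually_cutoff {x : Plane} (hx : x ∈ square) : ∀ᶠ y in 𝓝 x, cutoff y = 1 := by
  refine cutoff.eventuallyEq_one_of_mem_ball ?_
  have h := mem_square_iff.1 hx
  -- Points of the square have norm below √2, well inside the ball of radius 2 on which the cutoff
  -- is 1.
  rw [mem_ball_zero_iff, EuclideanSpace.norm_eq]
  change √_ < 2
  rw [Real.sqrt_lt' (by norm_num), Fin.sum_univ_two]
  simp only [Real.norm_eq_abs, sq_abs]
  nlinarith [(h 0).1, (h 0).2, (h 1).1, (h 1).2]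

/-- Smooth functions with compact support vanishing near the closed sides are test functions. -/
theorem IsPart.isTest {V : Type*} [NormedAddCommGroup V] [NormedSpace ℝ V] {Γ₀ : Set Plane}
    {S : Set Side} (h : IsPart Γ₀ S) {φ : Plane → V} (hφ : ContDiff ℝ ∞ φ)
    (hc : HasCompactSupport φ) {δ : ℝ} (hδ : 0 < δ)
    (h0 : ∀ s ∈ S, ∀ x : Plane, |x s.axis - s.level| < δ → φ x = 0) : IsTest Γ₀ φ := by
  refine ⟨hφ, hc, δ, hδ, fun x hx y hy => ?_⟩
  by_contra! hlt
  obtain ⟨s, hs, hys⟩ := h.exists_closed y hy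
  have hxs : |x s.axis - s.level| < δ := by
    rw [← hys.2, ← Real.dist_eq]
    exact (PiLp.dist_apply_le x y s.axis).trans_lt hlt
  have hopen : IsOpen {z : Plane | |z s.axis - s.level| < δ} :=
    isOpen_lt (by fun_prop) continuous_const
  have : φ =ᶠ[𝓝 x] 0 := by
    filter_upwards [hopen.mem_nhds hxs] with z hz
    exact h0 s hs z hz
  exact notMem_tsupport_iff_eventuallyEq.2 this hx

theorem clamp_near_level (n : ℕ) (s : Side) {r : ℝ} (hr : |r - s.level| < 1 / (n + 4)) :
    clamp n r = s.level := by
  have := abs_lt.1 hr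
  cases s <;> simp only [Side.level] at this ⊢
  · exact clamp_of_lt (by linarith)
  · exact clamp_of_gt (by linarith)
  · exact clamp_of_lt (by linarith)
  · exact clamp_of_gt (by linarith)

theorem deriv_clamp_near_level (n : ℕ) (s : Side) {r : ℝ} (hr : |r - s.level| < 1 / (n + 4)) :
    deriv (clamp n) r = 0 := by
  have hopen : IsOpen {z : ℝ | |z - s.level| < 1 / (n + 4)} :=
    isOpen_lt (by fun_prop) continuous_const
  have : clamp n =ᶠ[𝓝 r] fun _ => s.level := by
    filter_upwards [hopen.mem_nhds hr] with z hz
    exact clamp_near_level n s hz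
  rw [this.deriv_eq]
  simp

theorem clampMap_mem_closed (n : ℕ) (s : Side) {x : Plane}
    (hx : |x s.axis - s.level| < 1 / (n + 4)) : clampMap n x ∈ s.closed :=
  ⟨clampMap_mem n x, clamp_near_level n s hx⟩

theorem norm_le_of_coord (v : Plane) : ‖v‖ ≤ |v 0| + |v 1| := by
  rw [EuclideanSpace.norm_eq, Fin.sum_univ_two]
  simp only [Real.norm_eq_abs, sq_abs]
  refine Real.sqrt_le_iff.2 ⟨by positivity, ?_⟩
  nlinarith [sq_abs (v 0), sq_abs (v 1), mul_nonneg (abs_nonneg (v 0)) (abs_nonneg (v 1))]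

theorem gradient_apply (u : Plane → ℝ) (x : Plane) (i : Fin 2) :
    gradient u x i = fderiv ℝ u x (EuclideanSpace.single i 1) := by
  have : inner ℝ (gradient u x) (EuclideanSpace.single i 1) =
      fderiv ℝ u x (EuclideanSpace.single i 1) := by
    rw [gradient, InnerProductSpace.toDual_symm_apply]
  rw [← this, real_inner_comm, EuclideanSpace.inner_single_left]
  simp

theorem rot_eq {Φ : Plane → Plane} {x : Plane} (hΦ : DifferentiableAt ℝ Φ x) :
    rot Φ x = fderiv ℝ (fun y => Φ y 1) x (EuclideanSpace.single 0 1) -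
      fderiv ℝ (fun y => Φ y 0) x (EuclideanSpace.single 1 1) := by
  rw [fderiv_apply_coord hΦ, fderiv_apply_coord hΦ, rot]

theorem continuous_fderiv_single {u : Plane → ℝ} (hu : ContDiff ℝ ∞ u) (i : Fin 2) :
    Continuous fun x => fderiv ℝ u x (EuclideanSpace.single i 1) :=
  (hu.continuous_fderiv (by simp)).clm_apply continuous_const

theorem exists_bound_closedSquare {V : Type*} [NormedAddCommGroup V] {u : Plane → V}
    (hu : Continuous u) : ∃ C, ∀ x ∈ closedSquare, ‖u x‖ ≤ C :=
  isCompact_closedSquare.exists_bound_of_continuousOn hu.continuousOn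

/-- A smooth function vanishing on the sides in `S` belongs to the domain of the gradient with
boundary condition on these sides. -/
theorem IsPart.mem_gradOp {Γ₀ : Set Plane} {S : Set Side} (h : IsPart Γ₀ S) {u : Plane → ℝ}
    (hu : ContDiff ℝ ∞ u) (h0 : ∀ s ∈ S, ∀ x ∈ s.closed, u x = 0) :
    (toL2 u hu.continuous, toL2 (gradient u) (continuous_gradient hu)) ∈ (gradOp Γ₀).graph := by
  obtain ⟨C, hC0, hC⟩ := exists_deriv_clamp_le
  -- Near a side in `S`, `clampMap n` takes values on that side, where `u` vanishes; the cutoff only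
  -- provides compact support and is invisible on the square.
  let φ : ℕ → Plane → ℝ := fun n x => cutoff x * u (clampMap n x)
  have hloc : ∀ n, ∀ x ∈ square, φ n =ᶠ[𝓝 x] fun y => u (clampMap n y) := by
    intro n x hx
    filter_upwards [eventually_cutoff hx] with y hy
    simp [φ, hy]
  have hev : ∀ x ∈ square, ∀ᶠ n in atTop, φ n =ᶠ[𝓝 x] u := by
    intro x hx
    filter_upwards [eventually_clampMap_eq hx] with n hn
    filter_upwards [hloc n x hx, hn] with y h1 h2
    rw [h1, h2]
  refine mem_gradOp_graph (φ := φ) (fun n => ?_) _ _ ⟨?_, fun x hx => ?_⟩ ⟨?_, fun x hx => ?_⟩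
  · refine h.isTest (cutoff.contDiff.mul (hu.comp (contDiff_clampMap n)))
      cutoff.hasCompactSupport.mul_right (δ := 1 / (n + 4)) (by positivity) fun s hs x hx => ?_
    simp only [φ, h0 s hs _ (clampMap_mem_closed n s hx), mul_zero]
  · obtain ⟨K, hK⟩ := exists_bound_closedSquare hu.continuous
    refine ⟨K, fun n x hx => ?_⟩
    rw [(hloc n x hx).eq_of_nhds]
    exact hK _ (clampMap_mem n x)
  · exact tendsto_const_nhds.congr' ((hev x hx).mono fun n hn => hn.eq_of_nhds.symm)
  · obtain ⟨K, hK⟩ := exists_bound_closedSquare (continuous_fderiv_single hu 0)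
    obtain ⟨L, hL⟩ := exists_bound_closedSquare (continuous_fderiv_single hu 1)
    refine ⟨C * K + C * L, fun n x hx => ?_⟩
    refine (norm_le_of_coord _).trans ?_
    rw [gradient_apply, gradient_apply, (hloc n x hx).fderiv_eq, fderiv_comp_clampMap hu,
      fderiv_comp_clampMap hu, abs_mul, abs_mul]
    gcongr
    · exact hC _ _
    · exact hK _ (clampMap_mem n x)
    · exact hC _ _
    · exact hL _ (clampMap_mem n x)
  · refine tendsto_const_nhds.congr' ((hev x hx).mono fun n hn => ?_)
    simp only [gradient, hn.fderiv_eq]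

/-- The pullback of a vector field, seen as a one-form, along a clamping map. -/
def clampField (n : ℕ) (U : Plane → Plane) (x : Plane) : Plane :=
  WithLp.toLp 2 fun i => deriv (clamp n) (x i) * U (clampMap n x) i

theorem contDiff_clampField (n : ℕ) {U : Plane → Plane} (hU : ContDiff ℝ ∞ U) :
    ContDiff ℝ ∞ (clampField n U) := by
  have hd : ContDiff ℝ ∞ (deriv (clamp n)) := (contDiff_infty_iff_deriv.1 (contDiff_clamp n)).2
  exact contDiff_euclidean.2 fun i => (hd.comp (contDiff_coord i)).mul
    ((contDiff_coord i).comp (hU.comp (contDiff_clampMap n)))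

/-- Since `i ≠ j`, the factor depending on `x i` is not differentiated. Second derivatives of `clamp
n`, for which no uniform bound is available, therefore never enter the rotation. -/
theorem fderiv_clampField (n : ℕ) {U : Plane → Plane} (hU : ContDiff ℝ ∞ U) (x : Plane)
    {i j : Fin 2} (hij : i ≠ j) :
    fderiv ℝ (fun y => clampField n U y i) x (EuclideanSpace.single j 1) =
      deriv (clamp n) (x i) * deriv (clamp n) (x j) *
        fderiv ℝ (fun y => U y i) (clampMap n x) (EuclideanSpace.single j 1) := by
  have hd : ContDiff ℝ ∞ (deriv (clamp n)) := (contDiff_infty_iff_deriv.1 (contDiff_clamp n)).2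
  have hUi : ContDiff ℝ ∞ fun y => U y i := (contDiff_coord i).comp hU
  have h1 : DifferentiableAt ℝ (fun y : Plane => deriv (clamp n) (y i)) x :=
    (hd.comp (contDiff_coord i)).differentiable (by simp) x
  have h2 : DifferentiableAt ℝ (fun y : Plane => U (clampMap n y) i) x :=
    (hUi.comp (contDiff_clampMap n)).differentiable (by simp) x
  change fderiv ℝ (fun y => deriv (clamp n) (y i) * U (clampMap n y) i) x _ = _
  rw [fderiv_fun_mul h1 h2]
  simp only [_root_.add_apply, _root_.smul_apply, smul_eq_mul]
  rw [fderiv_comp_clampMap hUi, fderiv_comp_coord (hd.differentiable (by simp) _)]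
  simp [hij, mul_assoc]

/-- Pullback commutes with the exterior derivative: the rotation acquires the Jacobian determinant
of the clamping map. -/
theorem rot_clampField (n : ℕ) {U : Plane → Plane} (hU : ContDiff ℝ ∞ U) (x : Plane) :
    rot (clampField n U) x =
      deriv (clamp n) (x 0) * deriv (clamp n) (x 1) * rot U (clampMap n x) := by
  rw [rot_eq ((contDiff_clampField n hU).differentiable (by simp) x),
    rot_eq (hU.differentiable (by simp) _), fderiv_clampField n hU x one_ne_zero,
    fderiv_clampField n hU x zero_ne_one]
  ring

/-- A smooth vector field whose tangential component vanishes on the sides in `S` belongs to the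
domain of the rotation with boundary condition on these sides. -/
theorem IsPart.mem_rotOp {Γ₀ : Set Plane} {S : Set Side} (h : IsPart Γ₀ S) {U : Plane → Plane}
    (hU : ContDiff ℝ ∞ U) (h0 : ∀ s ∈ S, ∀ x ∈ s.closed, ∀ i, i ≠ s.axis → U x i = 0) :
    (toL2 U hU.continuous, toL2 (rot U) (continuous_rot hU)) ∈ (rotOp Γ₀).graph := by
  obtain ⟨C, hC0, hC⟩ := exists_deriv_clamp_le
  let Φ : ℕ → Plane → Plane := fun n x => cutoff x • clampField n U x
  have hloc : ∀ n, ∀ x ∈ square, Φ n =ᶠ[𝓝 x] clampField n U := by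
    intro n x hx
    filter_upwards [eventually_cutoff hx] with y hy
    simp [Φ, hy]
  have hev : ∀ x ∈ square, ∀ᶠ n in atTop, Φ n =ᶠ[𝓝 x] U := by
    intro x hx
    have hx' := mem_square_iff.1 hx
    filter_upwards [eventually_clampMap_eq hx, eventually_clamp_eq (hx' 0),
      eventually_clamp_eq (hx' 1)] with n hn hn0 hn1
    have c : ∀ i : Fin 2, Tendsto (fun y : Plane => y i) (𝓝 x) (𝓝 (x i)) := fun i =>
      (contDiff_coord i).continuous.tendsto x
    filter_upwards [hloc n x hx, hn, (c 0).eventually hn0.eventually_nhds,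
      (c 1).eventually hn1.eventually_nhds] with y h1 h2 h3 h4
    have e3 : deriv (clamp n) (y 0) = 1 := by
      rw [EventuallyEq.deriv_eq (f := id) h3]
      simp
    have e4 : deriv (clamp n) (y 1) = 1 := by
      rw [EventuallyEq.deriv_eq (f := id) h4]
      simp
    rw [h1]
    ext i
    fin_cases i
    · simp [clampField, h2, e3]
    · simp [clampField, h2, e4]
  refine mem_rotOp_graph (Φ := Φ) (fun n => ?_) _ _ ⟨?_, fun x hx => ?_⟩ ⟨?_, fun x hx => ?_⟩
  · refine h.isTest (cutoff.contDiff.smul (contDiff_clampField n hU))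
      cutoff.hasCompactSupport.smul_right (δ := 1 / (n + 4)) (by positivity) fun s hs x hx => ?_
    -- Near a side the normal component dies because `clamp n` is locally constant there, and the
    -- tangential component because it is evaluated on the side. Thus a tangential condition on `U`
    -- makes the whole pullback vanish.
    have : clampField n U x = 0 := by
      ext i
      by_cases hi : i = s.axis
      · subst hi
        simp [clampField, deriv_clamp_near_level n s hx]
      · simp [clampField, h0 s hs _ (clampMap_mem_closed n s hx) i hi]
    simp only [Φ, this, smul_zero]
  · obtain ⟨K, hK⟩ := exists_bound_closedSquare hU.continuous
    refine ⟨C * K + C * K, fun n x hx => ?_⟩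
    rw [(hloc n x hx).eq_of_nhds]
    refine (norm_le_of_coord _).trans ?_
    simp only [clampField, abs_mul]
    have hb := hK _ (clampMap_mem n x)
    have hc : ∀ i, |U (clampMap n x) i| ≤ K := fun i =>
      (PiLp.norm_apply_le (U (clampMap n x)) i).trans hb
    gcongr
    · exact hC _ _
    · exact hc _
    · exact hC _ _
    · exact hc _
  · exact tendsto_const_nhds.congr' ((hev x hx).mono fun n hn => hn.eq_of_nhds.symm)
  · obtain ⟨K, hK⟩ := exists_bound_closedSquare (continuous_rot hU)
    refine ⟨C * C * K, fun n x hx => ?_⟩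
    have : rot (Φ n) x = rot (clampField n U) x := by
      simp only [rot, (hloc n x hx).fderiv_eq]
    rw [this, rot_clampField n hU, norm_mul, norm_mul]
    gcongr
    · exact hC _ _
    · exact hC _ _
    · exact hK _ (clampMap_mem n x)
  · refine tendsto_const_nhds.congr' ((hev x hx).mono fun n hn => ?_)
    simp only [rot, hn.fderiv_eq]

/-! ### Eigenfunctions on the interval -/

open Classical in
/-- The phase of the modes: `0` for a Dirichlet and `π / 2` for a Neumann condition at `0`. -/
def phase (p : Prop) : ℝ := if p then 0 else Real.pi / 2

open Classical in
/-- Half the number of Dirichlet conditions at the two end points. -/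
def shift (p q : Prop) : ℝ := ((if p then 1 else 0) + (if q then 1 else 0)) / 2

/-- The frequencies of the modes. -/
def freq (p q : Prop) (j : ℕ) : ℝ := (j + shift p q) * Real.pi

/-- The eigenfunctions of the second derivative on the unit interval with a Dirichlet condition
at `0` if `p`, at `1` if `q`, and Neumann conditions otherwise. -/
def mode (p q : Prop) (j : ℕ) (x : ℝ) : ℝ := Real.sin (freq p q j * x + phase p)

theorem contDiff_mode (p q : Prop) (j : ℕ) : ContDiff ℝ ∞ (mode p q j) :=
  Real.contDiff_sin.comp ((contDiff_const.mul contDiff_id).add contDiff_const)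

theorem deriv_mode (p q : Prop) (j : ℕ) :
    deriv (mode p q j) = fun x => freq p q j * Real.cos (freq p q j * x + phase p) := by
  ext x
  have := (((hasDerivAt_id x).const_mul (freq p q j)).add_const (phase p)).sin
  refine HasDerivAt.deriv ?_
  convert! this using 1
  simp [mul_comm]

theorem deriv_deriv_mode (p q : Prop) (j : ℕ) :
    deriv (deriv (mode p q j)) = fun x => -freq p q j ^ 2 * mode p q j x := by
  rw [deriv_mode]
  ext x
  have := ((((hasDerivAt_id x).const_mul (freq p q j)).add_const (phase p)).cos).const_mul
    (freq p q j)
  refine HasDerivAt.deriv ?_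
  convert! this using 1
  simp [mode]
  ring

theorem shift_nonneg (p q : Prop) : 0 ≤ shift p q := by
  unfold shift
  positivity

theorem freq_nonneg (p q : Prop) (j : ℕ) : 0 ≤ freq p q j :=
  mul_nonneg (add_nonneg j.cast_nonneg (shift_nonneg p q)) Real.pi_pos.le

theorem freq_injective (p q : Prop) : Function.Injective (freq p q) := by
  intro i j h
  have := mul_right_cancel₀ Real.pi_ne_zero h
  exact_mod_cast add_right_cancel this

theorem freq_mono (p q : Prop) : Monotone (freq p q) := by
  intro i j h
  have : (i : ℝ) ≤ j := by exact_mod_cast h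
  exact mul_le_mul_of_nonneg_right (by linarith) Real.pi_pos.le

theorem mode_zero_of {p : Prop} (q : Prop) (hp : p) (j : ℕ) : mode p q j 0 = 0 := by
  simp [mode, phase, hp]

theorem deriv_mode_zero_of {p : Prop} (q : Prop) (hp : ¬p) (j : ℕ) :
    deriv (mode p q j) 0 = 0 := by
  simp [deriv_mode, phase, hp]

/-- `shift` is chosen so that, whatever the condition at 0, the argument of the sine at 1 is (j +
1)π under a Dirichlet condition at 1 and jπ + π/2 under a Neumann condition. -/
theorem mode_one_of (p : Prop) {q : Prop} (hq : q) (j : ℕ) : mode p q j 1 = 0 := by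
  by_cases hp : p
  · have : freq p q j * 1 + phase p = ((j + 1 : ℕ) : ℝ) * Real.pi := by
      simp [freq, phase, shift, hp, hq]
    rw [mode, this, Real.sin_nat_mul_pi]
  · have : freq p q j * 1 + phase p = ((j + 1 : ℕ) : ℝ) * Real.pi := by
      simp [freq, phase, shift, hp, hq]
      ring
    rw [mode, this, Real.sin_nat_mul_pi]

theorem deriv_mode_one_of (p : Prop) {q : Prop} (hq : ¬q) (j : ℕ) :
    deriv (mode p q j) 1 = 0 := by
  have : freq p q j * 1 + phase p = (j : ℝ) * Real.pi + Real.pi / 2 := by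
    by_cases hp : p
    · simp [freq, phase, shift, hp, hq]
      ring
    · simp [freq, phase, shift, hp, hq]
  rw [deriv_mode]
  simp only
  rw [this, Real.cos_add_pi_div_two, Real.sin_nat_mul_pi]
  simp

/-- On the open interval the argument of the sine stays in (0, π). The resulting positive ground
state serves as a weight in the completeness proof. -/
theorem mode_zero_pos (p q : Prop) {x : ℝ} (hx : x ∈ Ioo (0 : ℝ) 1) : 0 < mode p q 0 x := by
  have hpi := Real.pi_pos
  obtain ⟨h0, h1⟩ := hx
  have h2 : x * Real.pi < Real.pi := by nlinarith
  have h3 : 0 < x * Real.pi := by positivity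
  refine Real.sin_pos_of_pos_of_lt_pi ?_ ?_ <;>
  by_cases hp : p <;> by_cases hq : q <;> simp [freq, phase, shift, hp, hq] <;> nlinarith

/-- Multiplication by `cos (π x)` leaves the span of the modes invariant. -/
theorem exists_cos_mul_mode (p q : Prop) (j : ℕ) : ∃ (k : ℕ) (c : ℝ), ∀ x,
    Real.cos (Real.pi * x) * mode p q j x = 1 / 2 * mode p q (j + 1) x + c * mode p q k x := by
  have key : ∀ x, Real.cos (Real.pi * x) * mode p q j x = 1 / 2 * mode p q (j + 1) x +
      1 / 2 * Real.sin (freq p q j * x + phase p - Real.pi * x) := by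
    intro x
    have h1 : mode p q (j + 1) x = Real.sin (freq p q j * x + phase p + Real.pi * x) := by
      rw [mode]
      congr 1
      simp only [freq]
      push_cast
      ring
    rw [h1, mode, Real.sin_add (freq p q j * x + phase p), Real.sin_sub (freq p q j * x + phase p)]
    ring
  rcases j with _ | j
  -- For `j = 0` the lower neighbour has the frequency of index -1 and is folded back by symmetry of
  -- the sine: it vanishes (Dirichlet–Dirichlet), returns to mode 0 with sign - or + (mixed), or
  -- becomes mode 1 (Neumann–Neumann).
  · by_cases hp : p <;> by_cases hq : q
    · refine ⟨0, 0, fun x => (key x).trans ?_⟩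
      simp [freq, phase, shift, hp, hq]
    · refine ⟨0, -1 / 2, fun x => (key x).trans ?_⟩
      have : freq p q 0 * x + phase p - Real.pi * x = -(freq p q 0 * x + phase p) := by
        simp [freq, phase, shift, hp, hq]
        ring
      rw [this, Real.sin_neg, ← mode]
      ring
    · refine ⟨0, 1 / 2, fun x => (key x).trans ?_⟩
      have : freq p q 0 * x + phase p - Real.pi * x =
          Real.pi - (freq p q 0 * x + phase p) := by
        simp [freq, phase, shift, hp, hq]
        ring
      rw [this, Real.sin_pi_sub, ← mode]
    · refine ⟨1, 1 / 2, fun x => (key x).trans ?_⟩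
      have : freq p q 0 * x + phase p - Real.pi * x =
          Real.pi - (freq p q 1 * x + phase p) := by
        simp [freq, phase, shift, hp, hq]
        ring
      rw [this, Real.sin_pi_sub, ← mode]
  · refine ⟨j, 1 / 2, fun x => (key x).trans ?_⟩
    have : freq p q (j + 1) * x + phase p - Real.pi * x = freq p q j * x + phase p := by
      simp only [freq]
      push_cast
      ring
    rw [this, ← mode]

/-! ### Eigenfunctions on the square -/

/-- The product of two functions of one variable. -/
def tensor (f : Fin 2 → ℝ → ℝ) (x : Plane) : ℝ := f 0 (x 0) * f 1 (x 1)

theorem contDiff_tensor {f : Fin 2 → ℝ → ℝ} (hf : ∀ i, ContDiff ℝ ∞ (f i)) :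
    ContDiff ℝ ∞ (tensor f) :=
  ((hf 0).comp (contDiff_coord 0)).mul ((hf 1).comp (contDiff_coord 1))

theorem fderiv_tensor {f : Fin 2 → ℝ → ℝ} (hf : ∀ i, ContDiff ℝ ∞ (f i)) (x : Plane)
    (i : Fin 2) : fderiv ℝ (tensor f) x (EuclideanSpace.single i 1) =
      tensor (Function.update f i (deriv (f i))) x := by
  have hd : ∀ i, DifferentiableAt ℝ (fun y : Plane => f i (y i)) x := fun i =>
    ((hf i).comp (contDiff_coord i)).differentiable (by simp) x
  have h1 : ∀ i, DifferentiableAt ℝ (f i) (x i) := fun i => (hf i).differentiable (by simp) _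
  change fderiv ℝ (fun y : Plane => f 0 (y 0) * f 1 (y 1)) x _ = _
  rw [fderiv_fun_mul (hd 0) (hd 1)]
  simp only [_root_.add_apply, _root_.smul_apply, smul_eq_mul]
  rw [fderiv_comp_coord (h1 0), fderiv_comp_coord (h1 1)]
  fin_cases i
  · simp [tensor, mul_comm]
  · simp [tensor]

theorem fderiv_fderiv_tensor {f : Fin 2 → ℝ → ℝ} (hf : ∀ i, ContDiff ℝ ∞ (f i)) (x : Plane)
    (i : Fin 2) : fderiv ℝ (fun y => fderiv ℝ (tensor f) y (EuclideanSpace.single i 1)) x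
      (EuclideanSpace.single i 1) = tensor (Function.update f i (deriv (deriv (f i)))) x := by
  have h : (fun y => fderiv ℝ (tensor f) y (EuclideanSpace.single i 1)) =
      tensor (Function.update f i (deriv (f i))) := funext fun y => fderiv_tensor hf y i
  rw [h, fderiv_tensor, Function.update_idem, Function.update_self]
  intro j
  by_cases hj : j = i
  · subst hj
    rw [Function.update_self]
    exact (contDiff_infty_iff_deriv.1 (hf j)).2
  · rw [Function.update_of_ne hj]
    exact hf j

/-- The side on which a coordinate is `0`. -/
def lowSide : Fin 2 → Side := ![.l, .b]

/-- The side on which a coordinate is `1`. -/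
def highSide : Fin 2 → Side := ![.r, .t]

/-- The frequency in a coordinate direction, with Dirichlet conditions on the sides in `S`. -/
def sideFreq (S : Set Side) (i : Fin 2) (j : ℕ) : ℝ := freq (lowSide i ∈ S) (highSide i ∈ S) j

/-- The modes in a coordinate direction, with Dirichlet conditions on the sides in `S`. -/
def sideMode (S : Set Side) (i : Fin 2) (j : ℕ) : ℝ → ℝ := mode (lowSide i ∈ S) (highSide i ∈ S) j

theorem contDiff_sideMode (S : Set Side) (i : Fin 2) (j : ℕ) : ContDiff ℝ ∞ (sideMode S i j) :=
  contDiff_mode _ _ _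

/-- The eigenfunctions of the Laplacian with Dirichlet conditions on the sides in `S` and Neumann
conditions on the other sides. -/
def eigenfun (S : Set Side) (n : Fin 2 → ℕ) : Plane → ℝ := tensor fun i => sideMode S i (n i)

theorem contDiff_eigenfun (S : Set Side) (n : Fin 2 → ℕ) : ContDiff ℝ ∞ (eigenfun S n) :=
  contDiff_tensor fun _ => contDiff_mode _ _ _

theorem fderiv_fderiv_eigenfun (S : Set Side) (n : Fin 2 → ℕ) (i : Fin 2) (x : Plane) :
    fderiv ℝ (fun y => fderiv ℝ (eigenfun S n) y (EuclideanSpace.single i 1)) x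
      (EuclideanSpace.single i 1) = -sideFreq S i (n i) ^ 2 * eigenfun S n x := by
  rw [eigenfun, fderiv_fderiv_tensor (fun i => contDiff_sideMode S i (n i))]
  have h : deriv (deriv (sideMode S i (n i))) =
      fun x => -sideFreq S i (n i) ^ 2 * sideMode S i (n i) x := deriv_deriv_mode _ _ _
  rw [h]
  fin_cases i <;> simp [tensor] <;> ring

theorem eigenfun_eq_zero {S : Set Side} (n : Fin 2 → ℕ) {s : Side} (hs : s ∈ S) {x : Plane}
    (hx : x ∈ s.closed) : eigenfun S n x = 0 := by
  have h : sideMode S s.axis (n s.axis) (x s.axis) = 0 := by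
    rw [hx.2]
    cases s
    · exact mode_zero_of _ hs _
    · exact mode_one_of _ hs _
    · exact mode_zero_of _ hs _
    · exact mode_one_of _ hs _
  rw [eigenfun, tensor]
  rcases Fin.exists_fin_two.1 ⟨s.axis, rfl⟩ with ha | ha <;> rw [ha] at h <;> simp [h]

theorem fderiv_eigenfun_eq_zero {S : Set Side} (n : Fin 2 → ℕ) {s : Side} (hs : s ∉ S) {x : Plane}
    (hx : x ∈ s.closed) :
    fderiv ℝ (eigenfun S n) x (EuclideanSpace.single s.axis 1) = 0 := by
  have h : deriv (sideMode S s.axis (n s.axis)) (x s.axis) = 0 := by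
    rw [hx.2]
    cases s
    · exact deriv_mode_zero_of _ hs _
    · exact deriv_mode_one_of _ hs _
    · exact deriv_mode_zero_of _ hs _
    · exact deriv_mode_one_of _ hs _
  rw [eigenfun, fderiv_tensor (fun i => contDiff_sideMode S i (n i))]
  rcases Fin.exists_fin_two.1 ⟨s.axis, rfl⟩ with ha | ha <;> rw [ha] at h <;>
    simp [tensor, ha, h]

theorem exists_side {x : Plane} (hx : x ∈ closedSquare) {i : Fin 2} (h : x i = 0 ∨ x i = 1) :
    ∃ s : Side, s.axis = i ∧ x ∈ s.closed := by
  fin_cases i <;> rcases h with h | h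
  exacts [⟨.l, rfl, hx, h⟩, ⟨.r, rfl, hx, h⟩, ⟨.b, rfl, hx, h⟩, ⟨.t, rfl, hx, h⟩]

theorem contDiff_fderiv_single {u : Plane → ℝ} (hu : ContDiff ℝ ∞ u) (i : Fin 2) :
    ContDiff ℝ ∞ fun x => fderiv ℝ u x (EuclideanSpace.single i 1) :=
  (hu.fderiv_right (m := ∞) (by simp)).clm_apply contDiff_const

/-- Green's formula in one direction against an eigenfunction, for functions which vanish on the
sides in `S`. -/
theorem integral_fderiv_mul_fderiv_eigenfun {S : Set Side} {φ : Plane → ℝ}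
    (hφ : ContDiff ℝ ∞ φ) (h0 : ∀ s ∈ S, ∀ x ∈ s.closed, φ x = 0) (n : Fin 2 → ℕ) (i : Fin 2) :
    ∫ x, fderiv ℝ φ x (EuclideanSpace.single i 1) *
        fderiv ℝ (eigenfun S n) x (EuclideanSpace.single i 1) ∂vol =
      sideFreq S i (n i) ^ 2 * ∫ x, φ x * eigenfun S n x ∂vol := by
  rw [integral_parts_square (hφ.of_le (by simp))
    ((contDiff_fderiv_single (contDiff_eigenfun S n) i).of_le (by simp)) i ?_]
  · simp only [fderiv_fderiv_eigenfun]
    rw [← integral_const_mul, ← integral_neg]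
    refine integral_congr_ae (Eventually.of_forall fun x => ?_)
    simp only
    ring
  · intro x hx hxi
    obtain ⟨s, rfl, hs⟩ := exists_side hx hxi
    by_cases hS : s ∈ S
    · rw [h0 s hS x hs, zero_mul]
    · rw [fderiv_eigenfun_eq_zero n hS hs, mul_zero]

/-- Green's formula in a direction where the indices differ is symmetric in the two functions, while
the frequencies there are distinct and nonnegative. -/
theorem integral_eigenfun_mul_eigenfun (S : Set Side) {m n : Fin 2 → ℕ} (h : m ≠ n) :
    ∫ x, eigenfun S m x * eigenfun S n x ∂vol = 0 := by
  obtain ⟨i, hi⟩ := Function.ne_iff.1 h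
  have h1 := integral_fderiv_mul_fderiv_eigenfun (contDiff_eigenfun S m)
    (fun s hs x hx => eigenfun_eq_zero m hs hx) n i
  have h2 := integral_fderiv_mul_fderiv_eigenfun (contDiff_eigenfun S n)
    (fun s hs x hx => eigenfun_eq_zero n hs hx) m i
  simp only [mul_comm (eigenfun S n _), mul_comm (fderiv ℝ (eigenfun S n) _ _)] at h2
  rw [h1] at h2
  have hne : sideFreq S i (n i) ^ 2 - sideFreq S i (m i) ^ 2 ≠ 0 := by
    rw [sub_ne_zero, Ne, sideFreq, sideFreq, sq_eq_sq₀ (freq_nonneg _ _ _) (freq_nonneg _ _ _)]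
    exact fun h => hi (freq_injective _ _ h).symm
  refine (mul_eq_zero.1 ?_).resolve_left hne
  linear_combination h2

/-! ### Completeness of the eigenfunctions -/

theorem integrable_mul_vol {ψ : Plane → ℝ} (hψ : Continuous ψ) (y : L2) :
    Integrable (fun x => ψ x * y x) vol :=
  (memLp_vol hψ 2).integrable_mul (Lp.memLp y)

/-- `G` carries the cosine factors already accumulated, so that the step can be iterated. The
hypothesis must hold for all indices because each cosine moves the index. -/
theorem integral_cos_mul_eigenfun {S : Set Side} {y : L2} {G : Plane → ℝ} (hG : Continuous G)
    (h : ∀ n, ∫ x, G x * eigenfun S n x * y x ∂vol = 0) (i : Fin 2) (n : Fin 2 → ℕ) :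
    ∫ x, G x * Real.cos (Real.pi * x i) * eigenfun S n x * y x ∂vol = 0 := by
  obtain ⟨k, c, hk⟩ := exists_cos_mul_mode (lowSide i ∈ S) (highSide i ∈ S) (n i)
  have hpt : ∀ x : Plane, Real.cos (Real.pi * x i) * eigenfun S n x =
      1 / 2 * eigenfun S (Function.update n i (n i + 1)) x +
        c * eigenfun S (Function.update n i k) x := by
    intro x
    have := hk (x i)
    fin_cases i
    · simp only [eigenfun, tensor, sideMode] at this ⊢
      simp only [Fin.zero_eta, Function.update_self, Function.update_of_ne one_ne_zero] at this ⊢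
      linear_combination mode (lowSide 1 ∈ S) (highSide 1 ∈ S) (n 1) (x 1) * this
    · simp only [eigenfun, tensor, sideMode] at this ⊢
      simp only [Fin.mk_one, Function.update_self, Function.update_of_ne zero_ne_one] at this ⊢
      linear_combination mode (lowSide 0 ∈ S) (highSide 0 ∈ S) (n 0) (x 0) * this
  have hint : ∀ m, Integrable (fun x => G x * eigenfun S m x * y x) vol := fun m =>
    integrable_mul_vol (hG.mul (contDiff_eigenfun S m).continuous) y
  calc _ = ∫ x, (1 / 2 * (G x * eigenfun S (Function.update n i (n i + 1)) x * y x) +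
        c * (G x * eigenfun S (Function.update n i k) x * y x)) ∂vol := by
        refine integral_congr_ae (Eventually.of_forall fun x => ?_)
        simp only
        rw [mul_assoc (G x), hpt]
        ring
    _ = 0 := by
        rw [integral_add ((hint _).const_mul _) ((hint _).const_mul _), integral_const_mul,
          integral_const_mul, h, h]
        simp

theorem integral_cos_pow_mul_eigenfun {S : Set Side} {y : L2}
    (h : ∀ n, ∫ x, eigenfun S n x * y x ∂vol = 0) (a b : ℕ) : ∀ n : Fin 2 → ℕ,
    ∫ x, Real.cos (Real.pi * x 0) ^ a * Real.cos (Real.pi * x 1) ^ b * eigenfun S n x * y x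
      ∂vol = 0 := by
  induction a with
  | zero =>
    induction b with
    | zero => simpa using h
    | succ b ih =>
      intro n
      have := integral_cos_mul_eigenfun (by fun_prop) ih 1 n
      rw [← this]
      congr 1
      ext x
      ring
  | succ a ih =>
    intro n
    have := integral_cos_mul_eigenfun (by fun_prop) ih 0 n
    rw [← this]
    congr 1
    ext x
    ring

theorem integral_aeval_cos {S : Set Side} {y : L2}
    (h : ∀ n, ∫ x, eigenfun S n x * y x ∂vol = 0) (P : MvPolynomial (Fin 2) ℝ)
    (n : Fin 2 → ℕ) :
    ∫ x : Plane, MvPolynomial.eval (fun i => Real.cos (Real.pi * x i)) P * eigenfun S n x * y x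
      ∂vol = 0 := by
  simp only [MvPolynomial.eval_eq', Fin.prod_univ_two, Finset.sum_mul]
  rw [integral_finsetSum]
  · refine Finset.sum_eq_zero fun d _ => ?_
    simp only [mul_assoc (MvPolynomial.coeff d P)]
    rw [integral_const_mul, integral_cos_pow_mul_eigenfun h, mul_zero]
  · intro d _
    exact integrable_mul_vol (Continuous.mul (by fun_prop) (contDiff_eigenfun S n).continuous) y

/-- Continuous functions on the closed square are uniform limits of polynomials in
`cos (π x₀)` and `cos (π x₁)`. -/
theorem exists_poly_cos_near {ψ : Plane → ℝ} (hψ : Continuous ψ) {ε : ℝ} (hε : 0 < ε) :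
    ∃ P : MvPolynomial (Fin 2) ℝ, ∀ x ∈ closedSquare,
      |MvPolynomial.eval (fun i => Real.cos (Real.pi * x i)) P - ψ x| ≤ ε := by
  have : CompactSpace closedSquare := isCompact_iff_compactSpace.1 isCompact_closedSquare
  let f : Fin 2 → C(closedSquare, ℝ) := fun i =>
    ⟨fun x => Real.cos (Real.pi * (x : Plane) i), by fun_prop⟩
  let A : Subalgebra ℝ C(closedSquare, ℝ) := (MvPolynomial.aeval (R := ℝ) f).range
  have hsep : A.SeparatesPoints := by
    intro x y hxy
    have : ∃ i, (x : Plane) i ≠ (y : Plane) i := by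
      by_contra! h
      exact hxy (Subtype.ext (by ext i; exact h i))
    obtain ⟨i, hi⟩ := this
    refine ⟨f i, ⟨f i, ⟨MvPolynomial.X i, by simp⟩, rfl⟩, fun h => hi ?_⟩
    have hm : ∀ z : closedSquare, Real.pi * (z : Plane) i ∈ Icc 0 Real.pi := fun z =>
      ⟨mul_nonneg Real.pi_pos.le (z.2 i).1, mul_le_of_le_one_right Real.pi_pos.le (z.2 i).2⟩
    -- Points are separated because the cosine is injective on [0, π].
    exact mul_left_cancel₀ Real.pi_ne_zero (Real.injOn_cos (hm x) (hm y) h)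
  obtain ⟨⟨g, P, hP⟩, hg⟩ :=
    ContinuousMap.exists_mem_subalgebra_near_continuousMap_of_separatesPoints A hsep
      ⟨fun x => ψ x, by fun_prop⟩ ε hε
  refine ⟨P, fun x hx => ?_⟩
  have h1 := ((ContinuousMap.norm_lt_iff _ hε).1 hg ⟨x, hx⟩).le
  have h2 : g ⟨x, hx⟩ = MvPolynomial.eval (fun i => Real.cos (Real.pi * x i)) P := by
    rw [← hP]
    exact MvPolynomial.comp_aeval_apply f
      (ContinuousMap.evalAlgHom ℝ ℝ (⟨x, hx⟩ : closedSquare)) P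
  rw [← h2]
  exact h1

/-- With ρ the ground state, ρ y is orthogonal to all polynomials in the cosines, hence by uniform
approximation to every test function, so ρ y = 0. Positivity of ρ inside the square gives y = 0. -/
theorem eq_zero_of_integral_eigenfun {S : Set Side} {y : L2}
    (h : ∀ n, ∫ x, eigenfun S n x * y x ∂vol = 0) : y = 0 := by
  set ρ := eigenfun S 0 with hρdef
  have hρ : Continuous ρ := (contDiff_eigenfun S 0).continuous
  have hpos : ∀ x ∈ square, 0 < ρ x := fun x hx =>
    mul_pos (mode_zero_pos _ _ (mem_square_iff.1 hx 0)) (mode_zero_pos _ _ (mem_square_iff.1 hx 1))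
  have hint := integrable_mul_vol hρ y
  have hzero : (fun x => ρ x * y x) =ᵐ[vol] 0 := by
    refine ae_zero_of_pairing ((Lp.memLp y).mul (memLp_vol hρ ∞)) fun ψ hψ _ _ => ?_
    rw [← abs_nonpos_iff]
    have hle : ∀ ε > 0, |∫ x, ψ x * (ρ x * y x) ∂vol| ≤ ε * ∫ x, |ρ x * y x| ∂vol := by
      intro ε hε
      obtain ⟨P, hP⟩ := exists_poly_cos_near hψ.continuous hε
      have hPc : Continuous fun x : Plane =>
          MvPolynomial.eval (fun i => Real.cos (Real.pi * x i)) P := by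
        simp only [MvPolynomial.eval_eq']
        fun_prop
      have h1 := integral_aeval_cos h P 0
      have i1 : Integrable (fun x => MvPolynomial.eval (fun i => Real.cos (Real.pi * x i)) P *
          ρ x * y x) vol := integrable_mul_vol (hPc.mul hρ) y
      have i2 : Integrable (fun x => ψ x * ρ x * y x) vol :=
        integrable_mul_vol (hψ.continuous.mul hρ) y
      have : ∫ x, ψ x * (ρ x * y x) ∂vol = ∫ x, (ψ x * ρ x * y x -
          MvPolynomial.eval (fun i => Real.cos (Real.pi * x i)) P * ρ x * y x) ∂vol := by
        rw [integral_sub i2 i1, h1, sub_zero]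
        simp only [mul_assoc]
      rw [this, ← integral_const_mul]
      refine abs_integral_le_integral_abs.trans (integral_mono_ae (i2.sub i1).abs
        (hint.abs.const_mul ε) ?_)
      filter_upwards [ae_vol_mem] with x hx
      have := hP x (square_subset_closedSquare hx)
      rw [mul_assoc, mul_assoc, ← sub_mul, abs_mul, abs_sub_comm]
      gcongr
    refine le_of_forall_pos_le_add fun ε hε => ?_
    rw [zero_add]
    set I := ∫ x, |ρ x * y x| ∂vol
    have hI : 0 ≤ I := integral_nonneg fun x => abs_nonneg _
    -- The 1 in the denominator covers the case I = 0.
    refine (hle (ε / (I + 1)) (by positivity)).trans ?_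
    rw [div_mul_eq_mul_div, div_le_iff₀ (by positivity)]
    nlinarith
  refine Lp.eq_zero_iff_ae_eq_zero.2 ?_
  filter_upwards [hzero, ae_vol_mem] with x hx hxs
  exact (mul_eq_zero.1 hx).resolve_left (hpos x hxs).ne'

/-! ### Diagonalisation of the gradient and the rotation -/

/-- The square roots of the eigenvalues of the Laplacian with Dirichlet conditions on the sides in
`S` and Neumann conditions on the other sides. -/
def eigenroot (S : Set Side) (n : Fin 2 → ℕ) : ℝ :=
  √(sideFreq S 0 (n 0) ^ 2 + sideFreq S 1 (n 1) ^ 2)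

theorem eigenroot_sq (S : Set Side) (n : Fin 2 → ℕ) :
    eigenroot S n ^ 2 = sideFreq S 0 (n 0) ^ 2 + sideFreq S 1 (n 1) ^ 2 :=
  Real.sq_sqrt (by positivity)

/-- The class of an eigenfunction in `L²`. -/
def eigenL2 (S : Set Side) (n : Fin 2 → ℕ) : L2 :=
  toL2 (eigenfun S n) (contDiff_eigenfun S n).continuous

theorem toL2_const_mul (c : ℝ) {u : Plane → ℝ} (hu : Continuous u) :
    toL2 (fun x => c * u x) (continuous_const.mul hu) = c • toL2 u hu :=
  MemLp.toLp_const_smul c (memLp_vol hu 2)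

theorem eigenL2_orthogonal (S : Set Side) {m n : Fin 2 → ℕ} (h : m ≠ n) :
    inner ℝ (eigenL2 S m) (eigenL2 S n) = 0 := by
  rw [eigenL2, eigenL2, inner_toL2, ← integral_eigenfun_mul_eigenfun S h]
  simp [mul_comm]

theorem eigenL2_complete (S : Set Side) (y : L2) (h : ∀ n, inner ℝ (eigenL2 S n) y = 0) :
    y = 0 := by
  refine eq_zero_of_integral_eigenfun (S := S) fun n => ?_
  rw [← h n, L2.inner_def]
  refine integral_congr_ae ?_
  filter_upwards [coeFn_toL2 (contDiff_eigenfun S n).continuous] with x hx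
  rw [eigenL2, hx]
  simp [mul_comm]

theorem contDiff_gradient {u : Plane → ℝ} (hu : ContDiff ℝ ∞ u) : ContDiff ℝ ∞ (gradient u) :=
  contDiff_euclidean.2 fun i => by
    simp only [gradient_apply]
    exact contDiff_fderiv_single hu i

/-- The gradient of a function rotated by a quarter turn. -/
def curl (u : Plane → ℝ) (x : Plane) : Plane := !₂[gradient u x 1, -gradient u x 0]

theorem contDiff_curl {u : Plane → ℝ} (hu : ContDiff ℝ ∞ u) : ContDiff ℝ ∞ (curl u) := by
  have h := contDiff_euclidean.1 (contDiff_gradient hu)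
  refine contDiff_euclidean.2 fun i => ?_
  fin_cases i
  · exact h 1
  · exact (h 0).neg

/-- With this sign convention, rot ∘ curl is the negative Laplacian. -/
theorem rot_curl_eigenfun (S : Set Side) (n : Fin 2 → ℕ) :
    rot (curl (eigenfun S n)) = fun x => eigenroot S n ^ 2 * eigenfun S n x := by
  ext x
  rw [rot_eq ((contDiff_curl (contDiff_eigenfun S n)).differentiable (by simp) x), eigenroot_sq]
  have h0 := fderiv_fderiv_eigenfun S n 0 x
  have h1 := fderiv_fderiv_eigenfun S n 1 x
  have e1 : (fun y => curl (eigenfun S n) y 1) =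
      fun y => -fderiv ℝ (eigenfun S n) y (EuclideanSpace.single 0 1) := by
    ext y
    simp [curl, gradient_apply]
  have e0 : (fun y => curl (eigenfun S n) y 0) =
      fun y => fderiv ℝ (eigenfun S n) y (EuclideanSpace.single 1 1) := by
    ext y
    simp [curl, gradient_apply]
  rw [e0, e1, fderiv_fun_neg, _root_.neg_apply, h0, h1]
  ring

theorem inner_plane (v w : Plane) : inner ℝ v w = v 0 * w 0 + v 1 * w 1 := by
  simp [PiLp.inner_apply, mul_comm]

theorem integral_inner_gradient_eigenfun {S : Set Side} {φ : Plane → ℝ}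
    (hφ : ContDiff ℝ ∞ φ) (h0 : ∀ s ∈ S, ∀ x ∈ s.closed, φ x = 0) (n : Fin 2 → ℕ) :
    ∫ x, inner ℝ (gradient φ x) (gradient (eigenfun S n) x) ∂vol =
      ∫ x, φ x * (eigenroot S n ^ 2 * eigenfun S n x) ∂vol := by
  have hc : ∀ i, Integrable (fun x => fderiv ℝ φ x (EuclideanSpace.single i 1) *
      fderiv ℝ (eigenfun S n) x (EuclideanSpace.single i 1)) vol := fun i =>
    integrable_vol ((continuous_fderiv_single hφ i).mul
      (continuous_fderiv_single (contDiff_eigenfun S n) i))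
  simp only [inner_plane, gradient_apply]
  rw [integral_add (hc 0) (hc 1), integral_fderiv_mul_fderiv_eigenfun hφ h0,
    integral_fderiv_mul_fderiv_eigenfun hφ h0, ← add_mul, ← eigenroot_sq, ← integral_const_mul]
  congr 1
  ext x
  ring

/-- No boundary term survives: on each side either the eigenfunction (sides in `S`) or the field
(all others) vanishes. -/
theorem integral_rot_mul_eigenfun {S : Set Side} {Φ : Plane → Plane}
    (hΦ : ContDiff ℝ ∞ Φ) (h0 : ∀ s ∉ S, ∀ x ∈ s.closed, Φ x = 0) (n : Fin 2 → ℕ) :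
    ∫ x, rot Φ x * eigenfun S n x ∂vol =
      ∫ x, inner ℝ (Φ x) (curl (eigenfun S n) x) ∂vol := by
  have he := contDiff_eigenfun S n
  have hΦi : ∀ i : Fin 2, ContDiff ℝ ∞ fun x => Φ x i := fun i => (contDiff_coord i).comp hΦ
  have hparts : ∀ i j : Fin 2,
      ∫ x, fderiv ℝ (fun y => Φ y i) x (EuclideanSpace.single j 1) * eigenfun S n x ∂vol =
        -∫ x, Φ x i * fderiv ℝ (eigenfun S n) x (EuclideanSpace.single j 1) ∂vol := by
    intro i j
    refine integral_parts_square ((hΦi i).of_le (by simp)) (he.of_le (by simp)) j ?_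
    intro x hx hxj
    obtain ⟨s, rfl, hs⟩ := exists_side hx hxj
    by_cases hS : s ∈ S
    · rw [eigenfun_eq_zero n hS hs, mul_zero]
    · rw [h0 s hS x hs]
      simp
  have i1 : ∀ i j : Fin 2, Integrable (fun x =>
      fderiv ℝ (fun y => Φ y i) x (EuclideanSpace.single j 1) * eigenfun S n x) vol :=
    fun i j => integrable_vol ((continuous_fderiv_single (hΦi i) j).mul he.continuous)
  have i2 : ∀ i j : Fin 2, Integrable (fun x =>
      Φ x i * fderiv ℝ (eigenfun S n) x (EuclideanSpace.single j 1)) vol :=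
    fun i j => integrable_vol ((hΦi i).continuous.mul (continuous_fderiv_single he j))
  have hl : ∀ x, rot Φ x * eigenfun S n x =
      fderiv ℝ (fun y => Φ y 1) x (EuclideanSpace.single 0 1) * eigenfun S n x -
        fderiv ℝ (fun y => Φ y 0) x (EuclideanSpace.single 1 1) * eigenfun S n x := by
    intro x
    rw [rot_eq (hΦ.differentiable (by simp) x), sub_mul]
  have hr : ∀ x, inner ℝ (Φ x) (curl (eigenfun S n) x) =
      Φ x 0 * fderiv ℝ (eigenfun S n) x (EuclideanSpace.single 1 1) -
        Φ x 1 * fderiv ℝ (eigenfun S n) x (EuclideanSpace.single 0 1) := by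
    intro x
    rw [inner_plane, ← gradient_apply, ← gradient_apply]
    simp [curl]
    ring
  simp only [hl, hr]
  rw [integral_sub (i1 _ _) (i1 _ _), integral_sub (i2 _ _) (i2 _ _), hparts, hparts]
  ring

/-- If the mode vanished identically, its derivative at 1/2 would vanish too. Then either the
frequency is 0, which leaves only the positive mode `j = 0`, or sine and cosine vanish at the same
point. -/
theorem exists_mode_ne_zero (p q : Prop) (j : ℕ) : ∃ x ∈ Ioo (0 : ℝ) 1, mode p q j x ≠ 0 := by
  by_contra! h
  have hmem : (1 / 2 : ℝ) ∈ Ioo (0 : ℝ) 1 := by norm_num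
  have h0 := h _ hmem
  have h1 : deriv (mode p q j) (1 / 2) = 0 := by
    have : mode p q j =ᶠ[𝓝 (1 / 2)] fun _ => 0 := by
      filter_upwards [isOpen_Ioo.mem_nhds hmem] with x hx
      exact h x hx
    rw [this.deriv_eq]
    simp
  rw [deriv_mode] at h1
  rcases mul_eq_zero.1 h1 with h1 | h1
  · have hj : j = 0 := freq_injective p q (le_antisymm
      (h1.trans_le (freq_nonneg p q 0)) (freq_mono p q (Nat.zero_le j)))
    rw [hj] at h0
    exact (mode_zero_pos p q hmem).ne' h0
  · have := Real.sin_sq_add_cos_sq (freq p q j * (1 / 2) + phase p)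
    rw [mode] at h0
    rw [h0, h1] at this
    norm_num at this

theorem eigenL2_ne_zero (S : Set Side) (n : Fin 2 → ℕ) : eigenL2 S n ≠ 0 := by
  intro h
  have hc := (contDiff_eigenfun S n).continuous
  have hae : eigenfun S n =ᵐ[vol] 0 :=
    (coeFn_toL2 hc).symm.trans (Lp.eq_zero_iff_ae_eq_zero.1 h)
  have hzero := Measure.eqOn_open_of_ae_eq hae isOpen_square hc.continuousOn continuousOn_const
  obtain ⟨a, ha, ha0⟩ := exists_mode_ne_zero (lowSide 0 ∈ S) (highSide 0 ∈ S) (n 0)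
  obtain ⟨b, hb, hb0⟩ := exists_mode_ne_zero (lowSide 1 ∈ S) (highSide 1 ∈ S) (n 1)
  exact mul_ne_zero ha0 hb0 (hzero (x := !₂[a, b]) ⟨ha, hb⟩)

/-! ### The constants in terms of the smallest nonzero eigenvalue -/

theorem IsPart.c₀_eq {Γ₀ : Set Plane} {S : Set Side} (h : IsPart Γ₀ S) {n₀ : Fin 2 → ℕ}
    (hpos : 0 < eigenroot S n₀) (hmin : ∀ n, eigenroot S n ≠ 0 → eigenroot S n₀ ≤ eigenroot S n) :
    c₀ Γ₀ = ENNReal.ofReal (1 / eigenroot S n₀) := by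
  have he := contDiff_eigenfun S
  refine bestConstant_of_orthogonal (dense_domain_gradOp h.subset_frontier)
    (eigenL2_ne_zero S) (fun _ _ => eigenL2_orthogonal S) (eigenL2_complete S)
    (v := fun n => toL2 (gradient (eigenfun S n)) (continuous_gradient (he n)))
    (fun n => h.mem_gradOp (he n) fun s hs x hx => eigenfun_eq_zero n hs hx) (fun n => ?_) hpos hmin
  rw [eigenL2, ← toL2_const_mul]
  exact mem_gradOp_adjoint h.subset_frontier _ _ fun φ hφ =>
    integral_inner_gradient_eigenfun hφ.smooth (fun s hs x hx => h.eq_zero hφ hs hx) n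

/-- `S` is the Dirichlet set of the eigenfunctions, complementary to the sides where the rotation is
constrained. The eigenfunctions now live in the target space, which is why the dual diagonalisation
applies: the kernel of the rotation never has to be described. -/
theorem IsPart.c₁_eq {Γ₀ : Set Plane} {S : Set Side} (h : IsPart Γ₀ Sᶜ) {n₀ : Fin 2 → ℕ}
    (hpos : 0 < eigenroot S n₀) (hmin : ∀ n, eigenroot S n ≠ 0 → eigenroot S n₀ ≤ eigenroot S n) :
    c₁ Γ₀ = ENNReal.ofReal (1 / eigenroot S n₀) := by
  have he := contDiff_eigenfun S
  refine bestConstant_of_orthogonal_adjoint (dense_domain_rotOp h.subset_frontier)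
    (eigenL2_ne_zero S) (fun _ _ => eigenL2_orthogonal S) (eigenL2_complete S)
    (w := fun n => toL2 (curl (eigenfun S n)) (contDiff_curl (he n)).continuous)
    (fun n => ?_) (fun n => ?_) hpos hmin
  · exact mem_rotOp_adjoint h.subset_frontier _ _ fun Φ hΦ =>
      integral_rot_mul_eigenfun hΦ.smooth (fun s hs x hx => h.eq_zero hΦ hs hx) n
  · have := h.mem_rotOp (contDiff_curl (he n)) fun s hs x hx i hi => ?_
    · rw [eigenL2, ← toL2_const_mul]
      simpa only [rot_curl_eigenfun] using this
    · have h0 := fderiv_eigenfun_eq_zero n hs hx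
      rw [← gradient_apply] at h0
      rcases Fin.exists_fin_two.1 ⟨s.axis, rfl⟩ with ha | ha <;> rw [ha] at h0 hi <;>
        fin_cases i <;> simp_all [curl]

theorem eigenroot_zero_le (S : Set Side) (n : Fin 2 → ℕ) : eigenroot S 0 ≤ eigenroot S n := by
  have h : ∀ i, sideFreq S i 0 ^ 2 ≤ sideFreq S i (n i) ^ 2 := fun i =>
    pow_le_pow_left₀ (freq_nonneg _ _ _) (freq_mono _ _ (Nat.zero_le _)) 2
  exact Real.sqrt_le_sqrt (add_le_add (h 0) (h 1))

theorem eigenroot_zero (S : Set Side) : eigenroot S 0 =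
    √(shift (.l ∈ S) (.r ∈ S) ^ 2 + shift (.b ∈ S) (.t ∈ S) ^ 2) * Real.pi := by
  have h : ∀ a : ℝ, 0 ≤ a → √a * Real.pi = √(a * Real.pi ^ 2) := fun a ha => by
    rw [Real.sqrt_mul ha, Real.sqrt_sq Real.pi_pos.le]
  rw [eigenroot, h _ (by positivity)]
  congr 1
  simp [sideFreq, freq, lowSide, highSide]
  ring

theorem eigenroot_zero_pos {S : Set Side} (hS : S.Nonempty) : 0 < eigenroot S 0 := by
  rw [eigenroot_zero]
  refine mul_pos (Real.sqrt_pos.2 ?_) Real.pi_pos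
  have hp : ∀ {p q : Prop}, p ∨ q → 0 < shift p q := by
    intro p q h
    by_cases hp : p <;> by_cases hq : q <;> simp_all [shift]
  obtain ⟨s, hs⟩ := hS
  cases s
  · exact add_pos_of_nonneg_of_pos (sq_nonneg _) (pow_pos (hp (Or.inl hs)) 2)
  · exact add_pos_of_nonneg_of_pos (sq_nonneg _) (pow_pos (hp (Or.inr hs)) 2)
  · exact add_pos_of_pos_of_nonneg (pow_pos (hp (Or.inl hs)) 2) (sq_nonneg _)
  · exact add_pos_of_pos_of_nonneg (pow_pos (hp (Or.inr hs)) 2) (sq_nonneg _)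

theorem sideFreq_empty (i : Fin 2) (j : ℕ) : sideFreq ∅ i j = j * Real.pi := by
  simp [sideFreq, freq, shift]

/-- Without Dirichlet sides the index 0 gives the constants, with eigenvalue 0, so the first nonzero
eigenvalue sits at `![1, 0]` (and, by symmetry, at `![0, 1]`). -/
theorem eigenroot_empty : eigenroot ∅ ![1, 0] = Real.pi := by
  simp [eigenroot, sideFreq_empty, Real.sqrt_sq Real.pi_pos.le]

theorem eigenroot_empty_le (n : Fin 2 → ℕ) (hn : eigenroot ∅ n ≠ 0) :
    eigenroot ∅ ![1, 0] ≤ eigenroot ∅ n := by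
  rw [eigenroot_empty, eigenroot, sideFreq_empty, sideFreq_empty]
  refine Real.le_sqrt_of_sq_le ?_
  have hex : ∃ i, n i ≠ 0 := by
    by_contra! h
    exact hn (by simp [eigenroot, sideFreq_empty, h])
  obtain ⟨i, hi⟩ := hex
  have h1 : (1 : ℝ) ≤ n i := by exact_mod_cast Nat.one_le_iff_ne_zero.2 hi
  have h2 : Real.pi ^ 2 ≤ (n i * Real.pi) ^ 2 :=
    pow_le_pow_left₀ Real.pi_pos.le (le_mul_of_one_le_left Real.pi_pos.le h1) 2
  fin_cases i
  · exact h2.trans (le_add_of_nonneg_right (sq_nonneg _))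
  · exact h2.trans (le_add_of_nonneg_left (sq_nonneg _))

/-- The Maxwell constant of a boundary part is the Poincaré–Friedrichs constant of the
complementary boundary part. -/
theorem IsPart.c₁_eq_c₀ {Γ₀ Γ₁ : Set Plane} {S : Set Side} (h₁ : IsPart Γ₁ Sᶜ)
    (h₀ : IsPart Γ₀ S) : c₁ Γ₁ = c₀ Γ₀ := by
  rcases S.eq_empty_or_nonempty with rfl | hS
  · have hpos : 0 < eigenroot ∅ ![1, 0] := eigenroot_empty ▸ Real.pi_pos
    rw [h₁.c₁_eq hpos eigenroot_empty_le, h₀.c₀_eq hpos eigenroot_empty_le]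
  · have hpos := eigenroot_zero_pos hS
    have hmin := fun n (_ : eigenroot S n ≠ 0) => eigenroot_zero_le S n
    rw [h₁.c₁_eq hpos hmin, h₀.c₀_eq hpos hmin]

/-! ### Explicit values of the constants -/

theorem IsPart.c₀_of_empty {Γ₀ : Set Plane} (h : IsPart Γ₀ ∅) :
    c₀ Γ₀ = ENNReal.ofReal (1 / Real.pi) := by
  rw [h.c₀_eq (eigenroot_empty ▸ Real.pi_pos) eigenroot_empty_le, eigenroot_empty]

/-- Each direction contributes 0, 1/4 or 1 according to its number of Dirichlet ends. Hence r² is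
1/4 for one side, 1 for opposite sides, 1/2 for adjacent sides, 5/4 for three sides and 2 for all
four. -/
theorem IsPart.c₀_of_shift {Γ₀ : Set Plane} {S : Set Side} (h : IsPart Γ₀ S) {r : ℝ} (hr : 0 < r)
    (hS : shift (.l ∈ S) (.r ∈ S) ^ 2 + shift (.b ∈ S) (.t ∈ S) ^ 2 = r ^ 2) :
    c₀ Γ₀ = ENNReal.ofReal (1 / (r * Real.pi)) := by
  have he : eigenroot S 0 = r * Real.pi := by
    rw [eigenroot_zero, hS, Real.sqrt_sq hr.le]
  rw [h.c₀_eq (he ▸ mul_pos hr Real.pi_pos) (fun n _ => eigenroot_zero_le S n), he]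

open Side

theorem IsPart.c₀_of_one {Γ₀ : Set Plane} {S : Set Side} (h : IsPart Γ₀ S)
    (hS : S ∈ ({{b}, {t}, {l}, {r}} : Set (Set Side))) :
    c₀ Γ₀ = ENNReal.ofReal (2 / Real.pi) := by
  rw [h.c₀_of_shift (r := 1 / 2) (by norm_num)]
  · congr 1
    field_simp
  · rcases hS with rfl | rfl | rfl | rfl <;> simp [shift]

theorem IsPart.c₀_of_opposite {Γ₀ : Set Plane} {S : Set Side} (h : IsPart Γ₀ S)
    (hS : S ∈ ({{b, t}, {l, r}} : Set (Set Side))) :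
    c₀ Γ₀ = ENNReal.ofReal (1 / Real.pi) := by
  rw [h.c₀_of_shift (r := 1) (by norm_num), one_mul]
  rcases hS with rfl | rfl <;> simp [shift]

theorem IsPart.c₀_of_adjacent {Γ₀ : Set Plane} {S : Set Side} (h : IsPart Γ₀ S)
    (hS : S ∈ ({{b, l}, {b, r}, {t, l}, {t, r}} : Set (Set Side))) :
    c₀ Γ₀ = ENNReal.ofReal (√2 / Real.pi) := by
  have h2 : √2 ^ 2 = (2 : ℝ) := Real.sq_sqrt (by norm_num)
  rw [h.c₀_of_shift (r := √2 / 2) (by positivity)]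
  · congr 1
    field_simp
    linarith
  · rcases hS with rfl | rfl | rfl | rfl <;> simp [shift, div_pow, h2] <;> norm_num

theorem IsPart.c₀_of_three {Γ₀ : Set Plane} {S : Set Side} (h : IsPart Γ₀ S)
    (hS : S ∈ ({{b, l, r}, {t, l, r}, {b, t, l}, {b, t, r}} : Set (Set Side))) :
    c₀ Γ₀ = ENNReal.ofReal (2 / (√5 * Real.pi)) := by
  have h5 : √5 ^ 2 = (5 : ℝ) := Real.sq_sqrt (by norm_num)
  rw [h.c₀_of_shift (r := √5 / 2) (by positivity)]
  · congr 1
    field_simp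
  · rcases hS with rfl | rfl | rfl | rfl <;> simp [shift, div_pow, h5] <;> norm_num

theorem IsPart.c₀_of_univ {Γ₀ : Set Plane} (h : IsPart Γ₀ univ) :
    c₀ Γ₀ = ENNReal.ofReal (1 / (√2 * Real.pi)) := by
  refine h.c₀_of_shift (by positivity) ?_
  have h2 : √2 ^ 2 = (2 : ℝ) := Real.sq_sqrt (by norm_num)
  norm_num [shift, h2]

theorem IsPart.c₁_eq_c₀_compl {Γ₀ : Set Plane} {S T : Set Side} (h : IsPart Γ₀ S) (hT : Tᶜ = S) :
    c₁ Γ₀ = c₀ (boundaryPart T) :=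
  IsPart.c₁_eq_c₀ (S := T) (hT ▸ h) (isPart_boundaryPart T)

end UnitSquare

end

open UnitSquare UnitSquare.Side in
theorem mainTheorem5 :
    -- values of the constants `c_{0,Γ_τ}`
    (c₀ (boundaryPart ∅) = ENNReal.ofReal (1 / Real.pi) ∧
      (∀ S ∈ ({{b}, {t}, {l}, {r}} : Set (Set Side)),
        c₀ (boundaryPart S) = ENNReal.ofReal (2 / Real.pi)) ∧
      (∀ S ∈ ({{b, t}, {l, r}} : Set (Set Side)),
        c₀ (boundaryPart S) = ENNReal.ofReal (1 / Real.pi)) ∧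
      (∀ S ∈ ({{b, l}, {b, r}, {t, l}, {t, r}} : Set (Set Side)),
        c₀ (boundaryPart S) = ENNReal.ofReal (√2 / Real.pi)) ∧
      (∀ S ∈ ({{b, l, r}, {t, l, r}, {b, t, l}, {b, t, r}} : Set (Set Side)),
        c₀ (boundaryPart S) = ENNReal.ofReal (2 / (√5 * Real.pi))) ∧
      c₀ (frontier square) = ENNReal.ofReal (1 / (√2 * Real.pi))) ∧
    -- the identity `c_{1,Γ_ν} = c_{0,Γ_τ}` for complementary boundary parts
    (∀ S : Set Side, c₁ (complPart (boundaryPart S)) = c₀ (boundaryPart S)) ∧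
    -- values of the Maxwell constants
    (c₁ (boundaryPart ∅) = ENNReal.ofReal (1 / (√2 * Real.pi)) ∧
      (∀ S ∈ ({{b}, {t}, {l}, {r}} : Set (Set Side)),
        c₁ (boundaryPart S) = ENNReal.ofReal (2 / (√5 * Real.pi))) ∧
      (∀ S ∈ ({{b, t}, {l, r}} : Set (Set Side)),
        c₁ (boundaryPart S) = ENNReal.ofReal (1 / Real.pi)) ∧
      (∀ S ∈ ({{b, l}, {b, r}, {t, l}, {t, r}} : Set (Set Side)),
        c₁ (boundaryPart S) = ENNReal.ofReal (√2 / Real.pi)) ∧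
      (∀ S ∈ ({{b, l, r}, {t, l, r}, {b, t, l}, {b, t, r}} : Set (Set Side)),
        c₁ (boundaryPart S) = ENNReal.ofReal (2 / Real.pi)) ∧
      c₁ (frontier square) = ENNReal.ofReal (1 / Real.pi)) := by
  refine ⟨⟨(isPart_boundaryPart _).c₀_of_empty, fun S hS => (isPart_boundaryPart S).c₀_of_one hS,
    fun S hS => (isPart_boundaryPart S).c₀_of_opposite hS,
    fun S hS => (isPart_boundaryPart S).c₀_of_adjacent hS,
    fun S hS => (isPart_boundaryPart S).c₀_of_three hS, isPart_frontier.c₀_of_univ⟩,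
    fun S => (isPart_boundaryPart S).compl.c₁_eq_c₀ (isPart_boundaryPart S), ?_, ?_, ?_, ?_, ?_, ?_⟩
  -- The Maxwell values come from complementary sets of sides: none pairs with all, one with three,
  -- opposite with opposite, adjacent with adjacent.
  · rw [(isPart_boundaryPart ∅).c₁_eq_c₀_compl (T := Set.univ) (by simp)]
    exact (isPart_boundaryPart _).c₀_of_univ
  · intro S hS
    have : Sᶜ ∈ ({{b, l, r}, {t, l, r}, {b, t, l}, {b, t, r}} : Set (Set Side)) := by
      rcases hS with rfl | rfl | rfl | rfl
      exacts [Or.inr (Or.inl (by ext s; cases s <;> simp)),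
        Or.inl (by ext s; cases s <;> simp),
        Or.inr (Or.inr (Or.inr (by ext s; cases s <;> simp))),
        Or.inr (Or.inr (Or.inl (by ext s; cases s <;> simp)))]
    rw [(isPart_boundaryPart S).c₁_eq_c₀_compl (compl_compl S)]
    exact (isPart_boundaryPart _).c₀_of_three this
  · intro S hS
    have : Sᶜ ∈ ({{b, t}, {l, r}} : Set (Set Side)) := by
      rcases hS with rfl | rfl
      exacts [Or.inr (by ext s; cases s <;> simp),
        Or.inl (by ext s; cases s <;> simp)]
    rw [(isPart_boundaryPart S).c₁_eq_c₀_compl (compl_compl S)]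
    exact (isPart_boundaryPart _).c₀_of_opposite this
  · intro S hS
    have : Sᶜ ∈ ({{b, l}, {b, r}, {t, l}, {t, r}} : Set (Set Side)) := by
      rcases hS with rfl | rfl | rfl | rfl
      exacts [Or.inr (Or.inr (Or.inr (by ext s; cases s <;> simp))),
        Or.inr (Or.inr (Or.inl (by ext s; cases s <;> simp))),
        Or.inr (Or.inl (by ext s; cases s <;> simp)),
        Or.inl (by ext s; cases s <;> simp)]
    rw [(isPart_boundaryPart S).c₁_eq_c₀_compl (compl_compl S)]
    exact (isPart_boundaryPart _).c₀_of_adjacent this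
  · intro S hS
    have : Sᶜ ∈ ({{b}, {t}, {l}, {r}} : Set (Set Side)) := by
      rcases hS with rfl | rfl | rfl | rfl
      exacts [Or.inr (Or.inl (by ext s; cases s <;> simp)),
        Or.inl (by ext s; cases s <;> simp),
        Or.inr (Or.inr (Or.inr (by ext s; cases s <;> simp))),
        Or.inr (Or.inr (Or.inl (by ext s; cases s <;> simp)))]
    rw [(isPart_boundaryPart S).c₁_eq_c₀_compl (compl_compl S)]
    exact (isPart_boundaryPart _).c₀_of_one this
  · rw [isPart_frontier.c₁_eq_c₀_compl (T := ∅) (by simp)]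
    exact (isPart_boundaryPart _).c₀_of_empty
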